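/- Let $\mathbf k$ be a field of characteristic $0$ and $H=\mathbf k[s]$ the Hopf algebra with $\Delta(s)=s\otimes 1+1\otimes s$; put $s^{(n)}=s^n/n!$, and write $\otimes$ for $\otimes_{\mathbf k}$. A Lie $H$-pseudoalgebra is a left $H$-module $L$ with a biadditive pseudobracket $[\cdot,\cdot]:L\times L\to (H\otimes H)\otimes_H L$ (where $H$ acts on $H\otimes H$ through $\Delta$) such that $[h_1a_1,h_2a_2]=((h_1\otimes h_2)\otimes_H1)[a_1,a_2]$, $[a_1,a_2]=-((12)\otimes_H1)[a_2,a_1]$ and $[[a_1,a_2],a_3]=[a_1,[a_2,a_3]]-((12)\otimes_H1)[a_2,[a_1,a_3]]$ in $H^{\otimes3}\otimes_HL$ for all $h_i\in H$, $a_i\in L$. For $m\in\mathbb N$, an $m$-type Schrödinger–Virasoro Lie conformal algebra with parameters $\lambda_1,\lambda_2,\kappa_1,\kappa_2\in\mathbf k$ and $\alpha'_m,\eta\in H\otimes H$ is a Lie $H$-pseudoalgebra that is a free $H$-module $He_0\oplus He_1\oplus He_2$ with $$[e_0,e_0]=(s\otimes1-1\otimes s)\otimes_He_0,\quad [e_0,e_i]=\beta_i\otimes_He_i,\quad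 \beta_i=\lambda_is\otimes1-1\otimes s+\kappa_i\otimes1\quad(i=1,2),$$ $$[e_1,e_1]=\alpha'_m\otimes_He_2,\qquad[e_1,e_2]=\eta\otimes_He_2,\qquad[e_2,e_2]=0,$$ where $\alpha'_0=0$ and, for $m\ge1$, $\alpha'_m=\sum_{0\le i,j\le m}c_{ij}\,s^{(i)}\otimes s^{(j)}$ with $c_{ij}\in\mathbf k$ and the $c_{im},c_{mj}$ not all zero. Write $[i,j]=s^{(i)}\otimes s^{(j)}-s^{(j)}\otimes s^{(i)}$. Consider the following five kinds of parameters. (A) $m=0$, $\alpha'_0=0$, $\eta=a\otimes1$ with $a\in\mathbf k$, $a\lambda_1=a\kappa_1=0$ ($\lambda_1,\lambda_2,\kappa_1,\kappa_2\in\mathbf k$ otherwise arbitrary). (B) $m=1$, $\alpha'_1=w[0,1]$ with $0\ne w\in\mathbf k$, $\lambda_2=2\lambda_1-1$, $\kappa_2=2\kappa_1$, $\eta=a\otimes1$ with $a\in\mathbf k$, $a\lambda_1=a\kappa_1=0$. (C) $m=2$, $\alpha'_2=w\big([0,2]-\kappa_1[0,1]\big)$ with $0\neq w\in\mathbf k$,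 $\lambda_1=\frac12$, $\lambda_2=-1$, $\kappa_2=2\kappa_1$, $\eta=0$. (D) $m=2$, $\alpha'_2=-w\big(\kappa_1[0,2]-[1,2]-\frac{\kappa_1^2}2[0,1]\big)$ with $0\neq w\in\mathbf k$, $\lambda_1=0$, $\lambda_2=-3$, $\kappa_2=2\kappa_1$, $\eta=0$. (E) $m=3$, $\alpha'_3=w\big([0,3]+\frac12[1,2]-\frac{3\kappa_1}2[0,2]+\frac34\kappa_1^2[0,1]\big)$ with $0\neq w\in\mathbf k$, $\lambda_1=\frac23$, $\lambda_2=-\frac53$, $\kappa_2=2\kappa_1$, $\eta=0$. **Theorem 3.1.** (1) The parameters of every $m$-type Schrödinger–Virasoro Lie conformal algebra are of exactly one of the kinds (A)–(E); in particular $m\le3$. (2) Conversely, for all parameters of one of the kinds (A)–(E), the free $H$-module with basis $e_0,e_1,e_2$ carries the structure of an $m$-type Schrödinger–Virasoro Lie conformal algebra with these parameters. Moreover it is the subalgebra $He_0\oplus He_1\oplus He_2$ of a Lie $H$-pseudoalgebra that is free over $H$ on $e_0,e_1,e_2,e_3$ and satisfies in addition $[e_0,e_3]=(\lambda_3s\otimes1-1\otimes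 s+\kappa_3\otimes1)\otimes_He_3$ for some $\lambda_3,\kappa_3\in\mathbf k$, $[e_j,e_3]\in (H\otimes H)\otimes_H(He_1+He_2)$ for $j=1,2$, and $[e_3,e_3]=0$ (a Schrödinger–Virasoro Lie $H$-pseudoalgebra). (3) Each of the five kinds (A)–(E) occurs. -/

import Mathlib

open scoped TensorProduct Polynomial

noncomputable section

namespace SchrodingerVirasoro

section Hopf

variable (k : Type*) [Field k]

/-- The coproduct of the Hopf algebra `H = k[s]` (the variable `s` is `X`): the algebra map with
`Δ s = s ⊗ 1 + 1 ⊗ s`. -/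
def comul : k[X] →ₐ[k] k[X] ⊗[k] k[X] :=
  Polynomial.aeval ((Polynomial.X : k[X]) ⊗ₜ[k] (1 : k[X]) + (1 : k[X]) ⊗ₜ[k] (Polynomial.X : k[X]))

/-- The transposition `(12)` of `H ⊗ H`. -/
def swapTwo : k[X] ⊗[k] k[X] →ₐ[k] k[X] ⊗[k] k[X] :=
  (Algebra.TensorProduct.comm k k[X] k[X]).toAlgHom

/-- `Δ ⊗ 1 : H ⊗ H → H ⊗ H ⊗ H`. -/
def comulLeft : k[X] ⊗[k] k[X] →ₐ[k] k[X] ⊗[k] (k[X] ⊗[k] k[X]) :=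
  (Algebra.TensorProduct.assoc k k k k[X] k[X] k[X]).toAlgHom.comp
    (Algebra.TensorProduct.map (comul k) (AlgHom.id k k[X]))

/-- `1 ⊗ Δ : H ⊗ H → H ⊗ H ⊗ H`. -/
def comulRight : k[X] ⊗[k] k[X] →ₐ[k] k[X] ⊗[k] (k[X] ⊗[k] k[X]) :=
  Algebra.TensorProduct.map (AlgHom.id k k[X]) (comul k)

/-- `f ⊗ g ↦ f ⊗ g ⊗ 1`. -/
def inclLeft : k[X] ⊗[k] k[X] →ₐ[k] k[X] ⊗[k] (k[X] ⊗[k] k[X]) :=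
  Algebra.TensorProduct.map (AlgHom.id k k[X]) Algebra.TensorProduct.includeLeft

/-- `f ⊗ g ↦ 1 ⊗ f ⊗ g`. -/
def inclRight : k[X] ⊗[k] k[X] →ₐ[k] k[X] ⊗[k] (k[X] ⊗[k] k[X]) :=
  Algebra.TensorProduct.includeRight

/-- The transposition `(12)` of `H ⊗ H ⊗ H`. -/
def swapThree : k[X] ⊗[k] (k[X] ⊗[k] k[X]) →ₐ[k] k[X] ⊗[k] (k[X] ⊗[k] k[X]) :=
  (Algebra.TensorProduct.leftComm k k[X] k[X] k[X]).toAlgHom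

/-- `H ⊗ H`, regarded as an `H`-module (even `H`-algebra) through the coproduct. It is a type
synonym, since Mathlib lets `H` act on `k[X] ⊗[k] k[X]` through the first factor. -/
def HTwo : Type _ := k[X] ⊗[k] k[X]

/-- `H ⊗ H ⊗ H`, regarded as an `H`-module through the iterated coproduct. -/
def HThree : Type _ := k[X] ⊗[k] (k[X] ⊗[k] k[X])

instance : CommRing (HTwo k) := inferInstanceAs (CommRing (k[X] ⊗[k] k[X]))
instance : Algebra k (HTwo k) := inferInstanceAs (Algebra k (k[X] ⊗[k] k[X]))
instance : CommRing (HThree k) := inferInstanceAs (CommRing (k[X] ⊗[k] (k[X] ⊗[k] k[X])))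
instance : Algebra k (HThree k) := inferInstanceAs (Algebra k (k[X] ⊗[k] (k[X] ⊗[k] k[X])))

instance : Algebra k[X] (HTwo k) :=
  RingHom.toAlgebra (S := HTwo k) (comul k).toRingHom
instance : Algebra k[X] (HThree k) :=
  RingHom.toAlgebra (S := HThree k) ((comulRight k).comp (comul k)).toRingHom

variable {k}

/-- The element `f ⊗ g` of `H ⊗ H`. -/
def tens (f g : k[X]) : HTwo k := f ⊗ₜ[k] g

theorem swapTwo_comul (h : k[X]) : swapTwo k (comul k h) = comul k h := by
  have : (swapTwo k).comp (comul k) = comul k := by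
    ext; simp [swapTwo, comul, add_comm]
  exact DFunLike.congr_fun this h

theorem comulLeft_comul (h : k[X]) :
    comulLeft k (comul k h) = comulRight k (comul k h) := by
  have : (comulLeft k).comp (comul k) = (comulRight k).comp (comul k) := by
    ext
    simp [comulLeft, comulRight, comul, TensorProduct.add_tmul, TensorProduct.tmul_add, add_assoc,
      Algebra.TensorProduct.one_def]
  exact DFunLike.congr_fun this h

theorem swapThree_comul (h : k[X]) :
    swapThree k (comulRight k (comul k h)) = comulRight k (comul k h) := by
  have : (swapThree k).comp ((comulRight k).comp (comul k)) = (comulRight k).comp (comul k) := by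
    ext
    simp [swapThree, comulRight, comul, TensorProduct.tmul_add,
      Algebra.TensorProduct.one_def]
    abel
  exact DFunLike.congr_fun this h

variable (k)

/-- `(12)` on `H ⊗ H` is `H`-linear, because `H` is cocommutative. -/
def swapTwoH : HTwo k →ₐ[k[X]] HTwo k :=
  { (swapTwo k).toRingHom with commutes' := swapTwo_comul }

/-- `Δ ⊗ 1` is `H`-linear, by coassociativity. -/
def comulLeftH : HTwo k →ₐ[k[X]] HThree k :=
  { (comulLeft k).toRingHom with commutes' := comulLeft_comul }

/-- `1 ⊗ Δ` is `H`-linear. -/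
def comulRightH : HTwo k →ₐ[k[X]] HThree k :=
  { (comulRight k).toRingHom with commutes' := fun _ => rfl }

/-- `(12)` on `H ⊗ H ⊗ H` is `H`-linear. -/
def swapThreeH : HThree k →ₐ[k[X]] HThree k :=
  { (swapThree k).toRingHom with commutes' := swapThree_comul }

/-- `inclLeft` as a ring map between the type synonyms. -/
def inclLeftR : HTwo k →+* HThree k := (inclLeft k).toRingHom

/-- `inclRight` as a ring map between the type synonyms. -/
def inclRightR : HTwo k →+* HThree k := (inclRight k).toRingHom

variable {k}

theorem comulLeftH_tens (h : k[X]) :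
    comulLeftH k (tens h 1) = inclLeftR k (algebraMap k[X] (HTwo k) h) := by
  have : (comulLeft k).comp (Algebra.TensorProduct.includeLeft) = (inclLeft k).comp (comul k) := by
    ext
    simp [comulLeft, inclLeft, comul, TensorProduct.add_tmul]
  exact DFunLike.congr_fun this h

theorem comulRightH_tens (h : k[X]) :
    comulRightH k (tens 1 h) = inclRightR k (algebraMap k[X] (HTwo k) h) := by
  have : (comulRight k).comp (Algebra.TensorProduct.includeRight) =
      (inclRight k).comp (comul k) := by
    ext
    simp [comulRight, inclRight, comul]
  exact DFunLike.congr_fun this h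

end Hopf

section Pseudoalgebra

variable {k : Type*} [Field k] {L : Type*} [AddCommGroup L] [Module k[X] L]

theorem rTensor_smul {A B : Type*} [CommRing A] [CommRing B] [Algebra k[X] A] [Algebra k[X] B]
    (φ : A →ₐ[k[X]] B) (a : A) (t : A ⊗[k[X]] L) :
    φ.toLinearMap.rTensor L (a • t) = φ a • φ.toLinearMap.rTensor L t := by
  induction t with
  | zero => simp
  | tmul x y => simp [TensorProduct.smul_tmul']
  | add x y hx hy => simp only [smul_add, map_add, hx, hy]

variable (k L)

/-- An `H`-pseudoalgebra structure on the `H`-module `L`: a biadditive map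
`ρ : L × L → (H ⊗ H) ⊗_H L` with `ρ (h₁ a₁, h₂ a₂) = ((h₁ ⊗ h₂) ⊗_H 1) ρ (a₁, a₂)`. -/
structure Pseudoalgebra where
  /-- the pseudoproduct -/
  ρ : L →+ L →+ (HTwo k ⊗[k[X]] L)
  smul_smul' : ∀ (h₁ h₂ : k[X]) (a₁ a₂ : L), ρ (h₁ • a₁) (h₂ • a₂) = tens h₁ h₂ • ρ a₁ a₂

variable {k L}

namespace Pseudoalgebra

variable (P : Pseudoalgebra k L)

/-- The extension of the pseudoproduct that gives a meaning to `ρ (ρ (a ⊗ b) ⊗ c)`: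
`f ⊗_H a ↦ ((f ⊗ 1) ⊗_H 1) ((Δ ⊗ 1) ⊗_H 1) ρ (a ⊗ c)`. -/
def extLeft (c : L) : (HTwo k ⊗[k[X]] L) →+ (HThree k ⊗[k[X]] L) :=
  TensorProduct.liftAddHom
    (AddMonoidHom.mk'
      (fun f => AddMonoidHom.mk'
        (fun a => inclLeftR k f • (comulLeftH k).toLinearMap.rTensor L (P.ρ a c))
        (fun a b => by simp [smul_add]))
      (fun f g => by ext a; simp [add_smul]))
    (fun h f a => by
      have h1 : P.ρ (h • a) c = tens h 1 • P.ρ a c := by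
        simpa using P.smul_smul' h 1 a c
      simp only [AddMonoidHom.mk'_apply, h1, rTensor_smul, comulLeftH_tens, smul_smul,
        Algebra.smul_def, map_mul, mul_comm])

/-- The extension of the pseudoproduct that gives a meaning to `ρ (c ⊗ ρ (a ⊗ b))`:
`f ⊗_H a ↦ ((1 ⊗ f) ⊗_H 1) ((1 ⊗ Δ) ⊗_H 1) ρ (c ⊗ a)`. -/
def extRight (c : L) : (HTwo k ⊗[k[X]] L) →+ (HThree k ⊗[k[X]] L) :=
  TensorProduct.liftAddHom
    (AddMonoidHom.mk'
      (fun f => AddMonoidHom.mk'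
        (fun a => inclRightR k f • (comulRightH k).toLinearMap.rTensor L (P.ρ c a))
        (fun a b => by simp [smul_add]))
      (fun f g => by ext a; simp [add_smul]))
    (fun h f a => by
      have h1 : P.ρ c (h • a) = tens 1 h • P.ρ c a := by
        simpa using P.smul_smul' 1 h c a
      simp only [AddMonoidHom.mk'_apply, h1, rTensor_smul, comulRightH_tens, smul_smul,
        Algebra.smul_def, map_mul, mul_comm])

/-- The Jacobi identity (Leibniz `H`-pseudoalgebras). -/
def IsLeibniz : Prop :=
  ∀ a₁ a₂ a₃ : L,
    P.extLeft a₃ (P.ρ a₁ a₂) =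
      P.extRight a₁ (P.ρ a₂ a₃) -
        (swapThreeH k).toLinearMap.rTensor L (P.extRight a₂ (P.ρ a₁ a₃))

/-- A Lie `H`-pseudoalgebra is an asymmetric Leibniz `H`-pseudoalgebra. -/
structure IsLie : Prop where
  jacobi : P.IsLeibniz
  skew : ∀ a₁ a₂ : L, P.ρ a₁ a₂ = -((swapTwoH k).toLinearMap.rTensor L (P.ρ a₂ a₁))

/-- `ι` is a homomorphism of `H`-pseudoalgebras from `P` to `Q`. -/
def IsHom {M : Type*} [AddCommGroup M] [Module k[X] M] (Q : Pseudoalgebra k M)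
    (ι : L →ₗ[k[X]] M) : Prop :=
  ∀ a b : L, Q.ρ (ι a) (ι b) = ι.lTensor (HTwo k) (P.ρ a b)

end Pseudoalgebra

end Pseudoalgebra

section SV

variable {k : Type*} [Field k]

/-- The divided power `s^(n) = s^n / n!`. -/
def dpow (k : Type*) [Field k] (n : ℕ) : k[X] :=
  Polynomial.C ((n.factorial : k)⁻¹) * Polynomial.X ^ n

/-- The element `s^(i) ⊗ s^(j)` of `H ⊗ H`. -/
def monom (k : Type*) [Field k] (i j : ℕ) : HTwo k := tens (dpow k i) (dpow k j)

/-- The element `s^(i) ⊗ s^(j) - s^(j) ⊗ s^(i)` of `H ⊗ H`. -/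
def asym (k : Type*) [Field k] (i j : ℕ) : HTwo k := monom k i j - monom k j i

/-- `α = s ⊗ 1 - 1 ⊗ s`. -/
def alpha (k : Type*) [Field k] : HTwo k := tens Polynomial.X 1 - tens 1 Polynomial.X

/-- `β = l s ⊗ 1 - 1 ⊗ s + κ ⊗ 1`. -/
def beta (l κ : k) : HTwo k :=
  tens (Polynomial.C l * Polynomial.X) 1 - tens 1 Polynomial.X + tens (Polynomial.C κ) 1

/-- `A = ∑_{0 ≤ i, j ≤ m} c_ij s^(i) ⊗ s^(j)` where the `c_im`, `c_mj` are not all zero, if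
`m > 0`; and `A = 0` if `m = 0`. -/
def HasType (m : ℕ) (A : HTwo k) : Prop :=
  (m = 0 ∧ A = 0) ∨
  (0 < m ∧ ∃ c : ℕ → ℕ → k,
    A = ∑ i ∈ Finset.range (m + 1), ∑ j ∈ Finset.range (m + 1), c i j • monom k i j ∧
    ∃ i ≤ m, c i m ≠ 0 ∨ c m i ≠ 0)

variable {L : Type*} [AddCommGroup L] [Module k[X] L]

/-- `P` is an `m`-type Schrödinger-Virasoro Lie conformal algebra `H e₀ ⊕ H e₁ ⊕ H e₂` with the
parameters `λ₁ = l₁`, `λ₂ = l₂`, `κ₁`, `κ₂`, `α'_m = A` and `η`. -/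
structure IsMType (P : Pseudoalgebra k L) (e : Module.Basis (Fin 3) k[X] L) (m : ℕ)
    (l₁ l₂ κ₁ κ₂ : k) (A η : HTwo k) : Prop where
  lie : P.IsLie
  hasType : HasType m A
  b00 : P.ρ (e 0) (e 0) = alpha k ⊗ₜ[k[X]] e 0
  b01 : P.ρ (e 0) (e 1) = beta l₁ κ₁ ⊗ₜ[k[X]] e 1
  b02 : P.ρ (e 0) (e 2) = beta l₂ κ₂ ⊗ₜ[k[X]] e 2
  b11 : P.ρ (e 1) (e 1) = A ⊗ₜ[k[X]] e 2
  b12 : P.ρ (e 1) (e 2) = η ⊗ₜ[k[X]] e 2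
  b22 : P.ρ (e 2) (e 2) = 0

/-- `P` is a Schrödinger-Virasoro Lie `H`-pseudoalgebra `H e₀ ⊕ H e₁ ⊕ H e₂ ⊕ H e₃` with
`α'_m = A`; the remaining parameters of the brackets with `e₃` are left unnamed. -/
structure IsSV (P : Pseudoalgebra k L) (e : Module.Basis (Fin 4) k[X] L) (m : ℕ)
    (l₁ l₂ κ₁ κ₂ : k) (A η : HTwo k) : Prop where
  lie : P.IsLie
  hasType : HasType m A
  b00 : P.ρ (e 0) (e 0) = alpha k ⊗ₜ[k[X]] e 0
  b01 : P.ρ (e 0) (e 1) = beta l₁ κ₁ ⊗ₜ[k[X]] e 1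
  b02 : P.ρ (e 0) (e 2) = beta l₂ κ₂ ⊗ₜ[k[X]] e 2
  b03 : ∃ l₃ κ₃ : k, P.ρ (e 0) (e 3) = beta l₃ κ₃ ⊗ₜ[k[X]] e 3
  b11 : P.ρ (e 1) (e 1) = A ⊗ₜ[k[X]] e 2
  b12 : P.ρ (e 1) (e 2) = η ⊗ₜ[k[X]] e 2
  b13 : ∃ η₁₁ η₁₂ : HTwo k, P.ρ (e 1) (e 3) = η₁₁ ⊗ₜ[k[X]] e 1 + η₁₂ ⊗ₜ[k[X]] e 2
  b23 : ∃ η₂₁ η₂₂ : HTwo k, P.ρ (e 2) (e 3) = η₂₁ ⊗ₜ[k[X]] e 1 + η₂₂ ⊗ₜ[k[X]] e 2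
  b22 : P.ρ (e 2) (e 2) = 0
  b33 : P.ρ (e 3) (e 3) = 0

/-- The names of the five kinds. -/
inductive Kind where
  | A | B | C | D | E

/-- The description of the five kinds through the parameters of `IsMType`. -/
def Kind.Holds (t : Kind) (m : ℕ) (l₁ l₂ κ₁ κ₂ : k) (A η : HTwo k) : Prop :=
  match t with
  | .A => m = 0 ∧ A = 0 ∧ ∃ a : k, η = a • tens 1 1 ∧ a * l₁ = 0 ∧ a * κ₁ = 0
  | .B => m = 1 ∧ l₂ = 2 * l₁ - 1 ∧ κ₂ = 2 * κ₁ ∧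
      (∃ w : k, w ≠ 0 ∧ A = w • asym k 0 1) ∧
      ∃ a : k, η = a • tens 1 1 ∧ a * l₁ = 0 ∧ a * κ₁ = 0
  | .C => m = 2 ∧ l₁ = 1 / 2 ∧ l₂ = -1 ∧ κ₂ = 2 * κ₁ ∧ η = 0 ∧
      ∃ w : k, w ≠ 0 ∧ A = w • (asym k 0 2 - κ₁ • asym k 0 1)
  | .D => m = 2 ∧ l₁ = 0 ∧ l₂ = -3 ∧ κ₂ = 2 * κ₁ ∧ η = 0 ∧
      ∃ w : k, w ≠ 0 ∧
        A = (-w) • (κ₁ • asym k 0 2 - asym k 1 2 - (κ₁ ^ 2 / 2) • asym k 0 1)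
  | .E => m = 3 ∧ l₁ = 2 / 3 ∧ l₂ = -(5 / 3) ∧ κ₂ = 2 * κ₁ ∧ η = 0 ∧
      ∃ w : k, w ≠ 0 ∧
        A = w • (asym k 0 3 + (1 / 2 : k) • asym k 1 2 - (3 * κ₁ / 2) • asym k 0 2 +
          (3 / 4 * κ₁ ^ 2) • asym k 0 1)

end SV

end SchrodingerVirasoro

end

open SchrodingerVirasoro

/-! Elements of `H ⊗ H` and `H ⊗ H ⊗ H` are polynomials in two and three variables, and over an
infinite field they are determined by their values. `Δ ⊗ 1` then substitutes `x + y` for the first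
variable, so on a basis the Lie axioms become functional equations for the structure constants
(`isLeibniz_iff_evalTwo`, `skew_iff_evalTwo`). Write `A` for `α'_m`.

The Jacobi identity at `(1,1,2)` relates the polynomials `η(x,·)` and `η(y,·)` and, by comparing
leading terms, makes them constant (`evalTwo_eq_of_leibniz`). The identity at `(0,1,2)` then gives
`η = a ⊗ 1` with `a λ₁ = a κ₁ = 0`.

For `A ≠ 0`, the identity at `(0,1,1)` with `x = 0` gives `κ₂ = 2κ₁`, and translating both variables
by `κ₁` removes `κ₁`. In divided-power coefficients the equation becomes a recursion: the translated
tensor is homogeneous of some degree `d` with `λ₂ = 2λ₁ - d`, and one row of coefficients determines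
the others. Skew-symmetry leaves only `d = 1`; `d = 2` with `λ₁ = 1/2`; `d = 3` with `λ₁ = 2/3` or
`λ₁ = 0` (`CoeffRecursion.eq_asym`). Translating back yields (B), (C), (E), (D), and `A = 0` is (A).
In (C) and (E) `a = 0` because `λ₁ ≠ 0`; in (D) it follows from the identity at `(1,1,1)`.

Conversely the same equations suffice. An element `e₃` with `[e₀, e₃] = (-1 ⊗ s) ⊗_H e₃` that
commutes with `e₁`, `e₂` and itself can always be adjoined. -/

noncomputable section

namespace SchrodingerVirasoro

/-! ### Separating points of a tensor product by product functionals. -/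

section Separation

variable {k : Type*} [Field k]

/-- The functional `v ⊗ w ↦ φ v * ψ w`. -/
def tensorFunctional {V W : Type*} [AddCommGroup V] [Module k V] [AddCommGroup W] [Module k W]
    (φ : V →ₗ[k] k) (ψ : W →ₗ[k] k) : V ⊗[k] W →ₗ[k] k :=
  LinearMap.mul' k k ∘ₗ TensorProduct.map φ ψ

@[simp]
theorem tensorFunctional_tmul {V W : Type*} [AddCommGroup V] [Module k V] [AddCommGroup W]
    [Module k W] (φ : V →ₗ[k] k) (ψ : W →ₗ[k] k) (v : V) (w : W) :
    tensorFunctional φ ψ (v ⊗ₜ w) = φ v * ψ w := by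
  simp [tensorFunctional]

/-- Applying `ψ j` to the right factor gives an element of `V` killed by every `φ i`, hence zero. So
each coordinate of `t` in a basis of `V`, an element of `W`, is killed by every `ψ j`. Both
evaluations and coefficient functionals are used as `φ` and `ψ`. -/
theorem eq_zero_of_tensorFunctional {V W I J : Type*} [AddCommGroup V] [Module k V]
    [AddCommGroup W] [Module k W] (φ : I → V →ₗ[k] k) (ψ : J → W →ₗ[k] k)
    (hφ : ∀ v, (∀ i, φ i v = 0) → v = 0) (hψ : ∀ w, (∀ j, ψ j w = 0) → w = 0)
    (t : V ⊗[k] W) (h : ∀ i j, tensorFunctional (φ i) (ψ j) t = 0) : t = 0 := by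
  have hfac : ∀ i j, tensorFunctional (φ i) (ψ j) =
      φ i ∘ₗ (TensorProduct.rid k V).toLinearMap ∘ₗ LinearMap.lTensor V (ψ j) := by
    intro i j
    ext v w
    simp [mul_comm]
  have h1 : ∀ j, LinearMap.lTensor V (ψ j) t = 0 := by
    intro j
    apply (TensorProduct.rid k V).injective
    rw [map_zero]
    apply hφ
    intro i
    simpa [hfac] using h i j
  classical
  let b := Module.Basis.ofVectorSpace k V
  let E := TensorProduct.equivFinsuppOfBasisLeft (N := W) b
  have h2 : ∀ l, ∀ j, ψ j (E t l) = 0 := by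
    intro l j
    have h3 : ∀ u : V ⊗[k] W, ψ j (E u l) =
        TensorProduct.equivFinsuppOfBasisLeft (N := k) b (LinearMap.lTensor V (ψ j) u) l := by
      intro u
      induction u with
      | zero => simp
      | tmul v w => simp [E]
      | add u v hu hv => simp [hu, hv]
    rw [h3, h1]
    simp
  apply E.injective
  rw [map_zero]
  ext l
  exact hψ _ (h2 l)

end Separation

/-! ### Tensors as polynomial functions. -/

section Evaluation

variable {k : Type*} [Field k]

/-- Evaluation of a polynomial in two variables, given as an element of `k[X] ⊗ k[X]`. -/
def evalTensorTwo (a b : k) : k[X] ⊗[k] k[X] →ₐ[k] k :=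
  Algebra.TensorProduct.lift (Polynomial.aeval a) (Polynomial.aeval b) fun _ _ => Commute.all _ _

/-- Evaluation of a polynomial in three variables, given as an element of
`k[X] ⊗ (k[X] ⊗ k[X])`. -/
def evalTensorThree (a b c : k) : k[X] ⊗[k] (k[X] ⊗[k] k[X]) →ₐ[k] k :=
  Algebra.TensorProduct.lift (Polynomial.aeval a) (evalTensorTwo b c) fun _ _ => Commute.all _ _

theorem evalTensorThree_tmul (a b c : k) (f : k[X]) (g : k[X] ⊗[k] k[X]) :
    evalTensorThree a b c (f ⊗ₜ g) = Polynomial.aeval a f * evalTensorTwo b c g := by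
  simp [evalTensorThree]

/-- Evaluation of an element of `H ⊗ H`, regarded as a polynomial in two variables. -/
def evalTwo (a b : k) : HTwo k →ₐ[k] k := evalTensorTwo a b

/-- Evaluation of an element of `H ⊗ H ⊗ H`, regarded as a polynomial in three variables. -/
def evalThree (a b c : k) : HThree k →ₐ[k] k := evalTensorThree a b c

@[simp]
theorem evalTwo_tens (a b : k) (f g : k[X]) :
    evalTwo a b (tens f g) = f.eval a * g.eval b := by
  change evalTensorTwo a b (f ⊗ₜ g) = _
  simp [evalTensorTwo, Polynomial.aeval_def, Polynomial.eval₂_eq_eval_map]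

theorem evalThree_comulLeftH (a b c : k) (t : HTwo k) :
    evalThree a b c (comulLeftH k t) = evalTwo (a + b) c t := by
  have : (evalTensorThree a b c).comp (comulLeft k) =
      (evalTensorTwo (a + b) c) := by
    ext <;> simp [evalTensorThree, evalTensorTwo, comulLeft, comul, TensorProduct.add_tmul,
      Algebra.TensorProduct.one_def]
  exact DFunLike.congr_fun this t

theorem evalThree_comulRightH (a b c : k) (t : HTwo k) :
    evalThree a b c (comulRightH k t) = evalTwo a (b + c) t := by
  have : (evalTensorThree a b c).comp (comulRight k) =
      (evalTensorTwo a (b + c)) := by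
    ext <;> simp [evalTensorThree, evalTensorTwo, comulRight, comul]
  exact DFunLike.congr_fun this t

theorem evalThree_inclLeftR (a b c : k) (t : HTwo k) :
    evalThree a b c (inclLeftR k t) = evalTwo a b t := by
  have : (evalTensorThree a b c).comp (inclLeft k) =
      (evalTensorTwo a b) := by
    ext <;> simp [evalTensorThree, evalTensorTwo, inclLeft]
  exact DFunLike.congr_fun this t

theorem evalThree_inclRightR (a b c : k) (t : HTwo k) :
    evalThree a b c (inclRightR k t) = evalTwo b c t := by
  have : (evalTensorThree a b c).comp (inclRight k) =
      (evalTensorTwo b c) := by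
    ext <;> simp [evalTensorThree, evalTensorTwo, inclRight]
  exact DFunLike.congr_fun this t

theorem evalThree_swapThreeH (a b c : k) (t : HThree k) :
    evalThree a b c (swapThreeH k t) = evalThree b a c t := by
  have : (evalTensorThree a b c).comp (swapThree k) =
      (evalTensorThree b a c) := by
    ext <;> simp [evalTensorThree, evalTensorTwo, swapThree, Algebra.TensorProduct.one_def]
  exact DFunLike.congr_fun this t

theorem evalTwo_swapTwoH (a b : k) (t : HTwo k) :
    evalTwo a b (swapTwoH k t) = evalTwo b a t := by
  have : (evalTensorTwo a b).comp (swapTwo k) =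
      (evalTensorTwo b a) := by
    ext <;> simp [evalTensorTwo, swapTwo]
  exact DFunLike.congr_fun this t

variable [CharZero k]

theorem eq_zero_of_aeval (f : k[X]) (h : ∀ a : k, (Polynomial.aeval a).toLinearMap f = 0) :
    f = 0 :=
  Polynomial.funext fun a => by simpa [Polynomial.aeval_def, Polynomial.eval₂_eq_eval_map] using h a

theorem HTwo.ext_eval {s t : HTwo k} (h : ∀ a b, evalTwo a b s = evalTwo a b t) : s = t := by
  rw [← sub_eq_zero]
  refine eq_zero_of_tensorFunctional (V := k[X]) (W := k[X])
    (fun a : k => (Polynomial.aeval a).toLinearMap) (fun a : k => (Polynomial.aeval a).toLinearMap)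
    eq_zero_of_aeval eq_zero_of_aeval _ fun a b => ?_
  have : ∀ u : HTwo k, tensorFunctional (Polynomial.aeval a).toLinearMap
      (Polynomial.aeval b).toLinearMap u = evalTwo a b u := by
    have : tensorFunctional (Polynomial.aeval a).toLinearMap (Polynomial.aeval b).toLinearMap =
        (evalTensorTwo a b).toLinearMap := by
      apply TensorProduct.ext'
      intro f g
      simp [evalTensorTwo]
    exact DFunLike.congr_fun this
  rw [this, map_sub, h, sub_self]

theorem HThree.ext_eval {s t : HThree k} (h : ∀ a b c, evalThree a b c s = evalThree a b c t) :
    s = t := by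
  rw [← sub_eq_zero]
  refine eq_zero_of_tensorFunctional (V := k[X]) (W := HTwo k)
    (fun a : k => (Polynomial.aeval a).toLinearMap)
    (fun p : k × k => (evalTwo p.1 p.2).toLinearMap)
    eq_zero_of_aeval (fun w hw => HTwo.ext_eval fun a b => by simpa using hw (a, b)) _
    fun a p => ?_
  have : ∀ u : HThree k, tensorFunctional (W := HTwo k) (Polynomial.aeval a).toLinearMap
      (evalTwo p.1 p.2).toLinearMap u = evalThree a p.1 p.2 u := by
    have : tensorFunctional (W := HTwo k) (Polynomial.aeval a).toLinearMap
        (evalTwo p.1 p.2).toLinearMap =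
        (evalTensorThree a p.1 p.2).toLinearMap := by
      apply TensorProduct.ext'
      intro f g
      rw [tensorFunctional_tmul]
      exact (evalTensorThree_tmul a p.1 p.2 f g).symm
    exact DFunLike.congr_fun this
  rw [this, map_sub, h, sub_self]

end Evaluation

/-! ### Divided-power coefficients of tensors. -/

section Coefficients

variable {k : Type*} [Field k]

/-- The coefficient of `s^(n)`. -/
def coeffOne (n : ℕ) : k[X] →ₗ[k] k := (n.factorial : k) • Polynomial.lcoeff k n

theorem coeffOne_apply (n : ℕ) (f : k[X]) : coeffOne n f = n.factorial * f.coeff n := rfl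

/-- In divided powers `s · s^(n-1) = n s^(n)`. At `n = 0` the truncated `n - 1` is harmless because
of the factor `n`; the same holds in every formula derived from this one. -/
theorem coeffOne_X_mul (n : ℕ) (f : k[X]) :
    coeffOne n (Polynomial.X * f) = n * coeffOne (n - 1) f := by
  cases n with
  | zero => simp [coeffOne_apply]
  | succ n => simp [coeffOne_apply, Nat.factorial_succ, mul_assoc]

theorem coeffOne_dpow [CharZero k] (i j : ℕ) :
    coeffOne i (dpow k j) = if i = j then 1 else 0 := by
  by_cases h : i = j
  · subst h
    simp [coeffOne_apply, dpow, Nat.factorial_ne_zero]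
  · simp [coeffOne_apply, dpow, Polynomial.coeff_X_pow, h]

theorem eq_zero_of_coeffOne [CharZero k] (f : k[X]) (h : ∀ n, coeffOne n f = 0) : f = 0 := by
  ext n
  simpa [coeffOne_apply, Nat.factorial_ne_zero] using h n

/-- The coefficient of `s^(i) ⊗ s^(j)`. -/
def coeffTwo (i j : ℕ) : HTwo k →ₗ[k] k :=
  tensorFunctional (V := k[X]) (W := k[X]) (coeffOne i) (coeffOne j)

/-- The coefficient of `s^(n) ⊗ s^(i) ⊗ s^(j)`. -/
def coeffThree (n i j : ℕ) : HThree k →ₗ[k] k :=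
  tensorFunctional (V := k[X]) (W := k[X] ⊗[k] k[X]) (coeffOne n)
    (tensorFunctional (coeffOne i) (coeffOne j))

theorem HTwo.ext_coeff [CharZero k] {s t : HTwo k} (h : ∀ i j, coeffTwo i j s = coeffTwo i j t) :
    s = t := by
  rw [← sub_eq_zero]
  refine eq_zero_of_tensorFunctional (V := k[X]) (W := k[X]) coeffOne coeffOne
    eq_zero_of_coeffOne eq_zero_of_coeffOne _ fun i j => ?_
  change coeffTwo i j (s - t) = 0
  rw [map_sub, h, sub_self]

theorem coeffTwo_tens (i j : ℕ) (f g : k[X]) :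
    coeffTwo i j (tens f g) = coeffOne i f * coeffOne j g :=
  tensorFunctional_tmul _ _ _ _

theorem coeffTwo_monom [CharZero k] (i j p q : ℕ) :
    coeffTwo i j (monom k p q) = if i = p ∧ j = q then 1 else 0 := by
  rw [monom, coeffTwo_tens, coeffOne_dpow, coeffOne_dpow]
  by_cases h : i = p <;> by_cases h' : j = q <;> simp [h, h']

theorem tensorFunctional_X_mul {A : Type*} [CommRing A] [Algebra k A] (n : ℕ) (ψ : A →ₗ[k] k)
    (t : k[X] ⊗[k] A) : tensorFunctional (coeffOne n) ψ ((Polynomial.X ⊗ₜ[k] 1) * t) =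
      n * tensorFunctional (coeffOne (n - 1)) ψ t := by
  induction t with
  | zero => simp
  | tmul f a => simp [coeffOne_X_mul, mul_assoc]
  | add u v hu hv => simp [mul_add, hu, hv]

theorem tensorFunctional_mul_right {A : Type*} [CommRing A] [Algebra k A] (φ : k[X] →ₗ[k] k)
    (ψ ψ' : A →ₗ[k] k) (a : A) (c : k) (h : ∀ b, ψ (a * b) = c * ψ' b) (t : k[X] ⊗[k] A) :
    tensorFunctional φ ψ ((1 ⊗ₜ[k] a) * t) = c * tensorFunctional φ ψ' t := by
  induction t with
  | zero => simp
  | tmul f b => simp [h, mul_left_comm]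
  | add u v hu hv => simp [mul_add, hu, hv]

theorem coeffThree_fst_mul (n i j : ℕ) (t : HThree k) :
    coeffThree n i j (inclLeftR k (tens Polynomial.X 1) * t) = n * coeffThree (n - 1) i j t := by
  have h : inclLeft k (Polynomial.X ⊗ₜ[k] 1) = Polynomial.X ⊗ₜ[k] 1 := by
    simp [inclLeft, Algebra.TensorProduct.one_def]
  have h2 := tensorFunctional_X_mul n (tensorFunctional (coeffOne i) (coeffOne j)) t
  rw [← h] at h2
  exact h2

theorem coeffThree_snd_mul (n i j : ℕ) (t : HThree k) :
    coeffThree n i j (inclLeftR k (tens 1 Polynomial.X) * t) = i * coeffThree n (i - 1) j t := by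
  have h : inclLeft k (1 ⊗ₜ[k] Polynomial.X) = 1 ⊗ₜ[k] (Polynomial.X ⊗ₜ[k] 1) := by
    simp [inclLeft]
  have h2 := tensorFunctional_mul_right (coeffOne n) _ _ (Polynomial.X ⊗ₜ[k] (1 : k[X])) _
    (fun b => tensorFunctional_X_mul i (coeffOne j) b) t
  rw [← h] at h2
  exact h2

theorem coeffThree_trd_mul (n i j : ℕ) (t : HThree k) :
    coeffThree n i j (inclRightR k (tens 1 Polynomial.X) * t) = j * coeffThree n i (j - 1) t := by
  have h : inclRight k (1 ⊗ₜ[k] Polynomial.X) = 1 ⊗ₜ[k] ((1 : k[X]) ⊗ₜ[k] Polynomial.X) := by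
    simp [inclRight]
  have h2 := tensorFunctional_mul_right (coeffOne n) _ _ ((1 : k[X]) ⊗ₜ[k] Polynomial.X) _
    (fun b => tensorFunctional_mul_right (coeffOne i) _ _ _ _ (fun f => coeffOne_X_mul j f) b) t
  rw [← h] at h2
  exact h2

/-- This is `Δ s^(p) = ∑ s^(n) ⊗ s^(p-n)`, free of binomial coefficients; it is the reason for using
divided powers. -/
theorem tensorFunctional_comul (n i : ℕ) (f : k[X]) :
    tensorFunctional (coeffOne n) (coeffOne i) (comul k f) = coeffOne (n + i) f := by
  have key : ∀ p n i, tensorFunctional (coeffOne n) (coeffOne i) (comul k (Polynomial.X ^ p)) =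
      coeffOne (n + i) (Polynomial.X ^ p : k[X]) := by
    intro p
    induction p with
    | zero =>
      intro n i
      rw [pow_zero, map_one, Algebra.TensorProduct.one_def, tensorFunctional_tmul]
      rcases n with _ | n <;> rcases i with _ | i <;>
        simp [coeffOne_apply, Polynomial.coeff_one]
    | succ p ih =>
      intro n i
      have h1 : comul k (Polynomial.X ^ (p + 1)) =
          (Polynomial.X ⊗ₜ[k] 1) * comul k (Polynomial.X ^ p) +
          (1 ⊗ₜ[k] Polynomial.X) * comul k (Polynomial.X ^ p) := by
        rw [pow_succ', map_mul, ← add_mul]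
        simp [comul]
      rw [h1, map_add, tensorFunctional_X_mul,
        tensorFunctional_mul_right _ _ _ _ _ (fun f => coeffOne_X_mul i f), ih, ih, pow_succ',
        coeffOne_X_mul]
      rcases n with _ | n <;> rcases i with _ | i <;> simp
      rw [show n + 1 + i = n + (i + 1) by ring]
      ring
  have : tensorFunctional (coeffOne n) (coeffOne i) ∘ₗ (comul k).toLinearMap =
      coeffOne (n + i) := by
    apply Polynomial.lhom_ext'
    intro p
    ext
    simpa [Polynomial.X_pow_eq_monomial] using key p n i
  exact DFunLike.congr_fun this f

theorem coeffThree_comulLeftH (n i j : ℕ) (t : HTwo k) :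
    coeffThree n i j (comulLeftH k t) = coeffTwo (n + i) j t := by
  have h1 : ∀ (u : k[X] ⊗[k] k[X]) (g : k[X]), coeffThree n i j
      ((Algebra.TensorProduct.assoc k k k k[X] k[X] k[X]) (u ⊗ₜ g)) =
        tensorFunctional (coeffOne n) (coeffOne i) u * coeffOne j g := by
    intro u g
    induction u with
    | zero => simp only [TensorProduct.zero_tmul, map_zero, zero_mul]; exact map_zero _
    | tmul a b =>
      rw [Algebra.TensorProduct.assoc_tmul]
      change tensorFunctional _ _ _ = _
      simp [mul_assoc]
    | add u v hu hv =>
      rw [TensorProduct.add_tmul, map_add, map_add, add_mul, ← hu, ← hv]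
      exact map_add _ _ _
  have h2 : (coeffThree n i j : k[X] ⊗[k] (k[X] ⊗[k] k[X]) →ₗ[k] k) ∘ₗ
      (comulLeft k).toLinearMap = coeffTwo (n + i) j := by
    apply TensorProduct.ext'
    intro f g
    refine (h1 (comul k f) g).trans ?_
    rw [tensorFunctional_comul]
    exact (coeffTwo_tens _ _ _ _).symm
  exact DFunLike.congr_fun h2 t

theorem coeffThree_swapThreeH_comulRightH (n i j : ℕ) (t : HTwo k) :
    coeffThree n i j (swapThreeH k (comulRightH k t)) = coeffTwo i (n + j) t := by
  have h1 : ∀ (u : k[X] ⊗[k] k[X]) (f : k[X]), coeffThree n i j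
      ((Algebra.TensorProduct.leftComm k k[X] k[X] k[X]) (f ⊗ₜ u)) =
        coeffOne i f * tensorFunctional (coeffOne n) (coeffOne j) u := by
    intro u f
    induction u with
    | zero => simp only [TensorProduct.tmul_zero, map_zero, mul_zero]; exact map_zero _
    | tmul a b =>
      rw [Algebra.TensorProduct.leftComm_tmul]
      change tensorFunctional _ _ _ = _
      simp [mul_left_comm]
    | add u v hu hv =>
      rw [TensorProduct.tmul_add, map_add, map_add, mul_add, ← hu, ← hv]
      exact map_add _ _ _
  have h2 : (coeffThree n i j : k[X] ⊗[k] (k[X] ⊗[k] k[X]) →ₗ[k] k) ∘ₗ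
      (swapThree k).toLinearMap ∘ₗ (comulRight k).toLinearMap = coeffTwo i (n + j) := by
    apply TensorProduct.ext'
    intro f g
    refine (h1 (comul k g) f).trans ?_
    rw [tensorFunctional_comul]
    exact (coeffTwo_tens _ _ _ _).symm
  exact DFunLike.congr_fun h2 t

theorem coeffThree_inclRightR (n i j : ℕ) (t : HTwo k) :
    coeffThree n i j (inclRightR k t) = if n = 0 then coeffTwo i j t else 0 := by
  refine (tensorFunctional_tmul (V := k[X]) (W := k[X] ⊗[k] k[X]) _ _ 1 t).trans ?_
  cases n
  · simp [coeffOne_apply, coeffTwo]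
    rfl
  · simp [coeffOne_apply, Polynomial.coeff_one]

theorem coeffTwo_swapTwoH (i j : ℕ) (t : HTwo k) :
    coeffTwo i j (swapTwoH k t) = coeffTwo j i t := by
  have h2 : (coeffTwo i j : k[X] ⊗[k] k[X] →ₗ[k] k) ∘ₗ (swapTwo k).toLinearMap =
      coeffTwo j i := by
    apply TensorProduct.ext'
    intro f g
    refine (coeffTwo_tens i j g f).trans ?_
    rw [mul_comm]
    exact (coeffTwo_tens _ _ _ _).symm
  exact DFunLike.congr_fun h2 t

end Coefficients

theorem tens_mul_tens {k : Type*} [Field k] (f g f' g' : k[X]) :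
    tens f g * tens f' g' = tens (f * f') (g * g') :=
  Algebra.TensorProduct.tmul_mul_tmul f f' g g'

theorem tens_one_one {k : Type*} [Field k] : tens (1 : k[X]) 1 = 1 := rfl

theorem tens_zero_left {k : Type*} [Field k] (g : k[X]) : tens 0 g = 0 :=
  TensorProduct.zero_tmul _ _

theorem tens_zero_right {k : Type*} [Field k] (f : k[X]) : tens f 0 = 0 :=
  TensorProduct.tmul_zero _ _

/-! ### Reduction of the Lie axioms to a basis. -/

section BasisInduction

theorem basis_induction {R M ι : Type*} [Semiring R] [AddCommMonoid M] [Module R M]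
    (e : Module.Basis ι R M) {p : M → Prop} (basis : ∀ i, p (e i))
    (add : ∀ a b, p a → p b → p (a + b)) (smul : ∀ (r : R) a, p a → p (r • a)) (zero : p 0)
    (a : M) : p a := by
  refine Submodule.span_induction (p := fun x _ => p x) ?_ zero (fun x y _ _ => add x y)
    (fun r x _ => smul r x) (e.mem_span a)
  rintro _ ⟨i, rfl⟩
  exact basis i

end BasisInduction

namespace Pseudoalgebra

variable {k : Type*} [Field k] {L : Type*} [AddCommGroup L] [Module k[X] L]

section Basic

variable (P : Pseudoalgebra k L)

theorem ρ_smul_left (h : k[X]) (a b : L) : P.ρ (h • a) b = tens h 1 • P.ρ a b := by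
  simpa using P.smul_smul' h 1 a b

theorem ρ_smul_right (h : k[X]) (a b : L) : P.ρ a (h • b) = tens 1 h • P.ρ a b := by
  simpa using P.smul_smul' 1 h a b

theorem extLeft_tmul (c : L) (f : HTwo k) (a : L) : P.extLeft c (f ⊗ₜ a) =
    inclLeftR k f • (comulLeftH k).toLinearMap.rTensor L (P.ρ a c) := rfl

theorem extRight_tmul (c : L) (f : HTwo k) (a : L) : P.extRight c (f ⊗ₜ a) =
    inclRightR k f • (comulRightH k).toLinearMap.rTensor L (P.ρ c a) := rfl

theorem extLeft_smul (c : L) (t : HTwo k) (u : HTwo k ⊗[k[X]] L) :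
    P.extLeft c (t • u) = inclLeftR k t • P.extLeft c u := by
  induction u with
  | zero => simp
  | tmul f a => rw [TensorProduct.smul_tmul', smul_eq_mul, extLeft_tmul, map_mul, mul_smul,
      extLeft_tmul]
  | add u v hu hv => rw [smul_add, map_add, map_add, hu, hv, smul_add]

theorem extRight_smul (c : L) (t : HTwo k) (u : HTwo k ⊗[k[X]] L) :
    P.extRight c (t • u) = inclRightR k t • P.extRight c u := by
  induction u with
  | zero => simp
  | tmul f a => rw [TensorProduct.smul_tmul', smul_eq_mul, extRight_tmul, map_mul, mul_smul,
      extRight_tmul]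
  | add u v hu hv => rw [smul_add, map_add, map_add, hu, hv, smul_add]

theorem extLeft_add (c d : L) (u : HTwo k ⊗[k[X]] L) :
    P.extLeft (c + d) u = P.extLeft c u + P.extLeft d u := by
  induction u with
  | zero => simp
  | tmul f a => simp only [extLeft_tmul, map_add, smul_add]
  | add u v hu hv => rw [map_add, map_add, map_add, hu, hv, add_add_add_comm]

theorem extRight_add (c d : L) (u : HTwo k ⊗[k[X]] L) :
    P.extRight (c + d) u = P.extRight c u + P.extRight d u := by
  induction u with
  | zero => simp
  | tmul f a => simp only [extRight_tmul, map_add, AddMonoidHom.add_apply, smul_add]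
  | add u v hu hv => rw [map_add, map_add, map_add, hu, hv, add_add_add_comm]

/-- The defect of the Jacobi identity. -/
def jacobiator (a b c : L) : HThree k ⊗[k[X]] L :=
  P.extLeft c (P.ρ a b) - (P.extRight a (P.ρ b c) -
    (swapThreeH k).toLinearMap.rTensor L (P.extRight b (P.ρ a c)))

theorem isLeibniz_iff_jacobiator : P.IsLeibniz ↔ ∀ a b c, P.jacobiator a b c = 0 := by
  simp only [IsLeibniz, jacobiator, sub_eq_zero]

theorem jacobiator_add_left (a a' b c : L) :
    P.jacobiator (a + a') b c = P.jacobiator a b c + P.jacobiator a' b c := by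
  simp only [jacobiator, map_add, AddMonoidHom.add_apply, extRight_add]
  abel

theorem jacobiator_add_mid (a b b' c : L) :
    P.jacobiator a (b + b') c = P.jacobiator a b c + P.jacobiator a b' c := by
  simp only [jacobiator, map_add, AddMonoidHom.add_apply, extRight_add]
  abel

theorem jacobiator_add_right (a b c c' : L) :
    P.jacobiator a b (c + c') = P.jacobiator a b c + P.jacobiator a b c' := by
  simp only [jacobiator, map_add, extLeft_add]
  abel

variable [CharZero k]

theorem extLeft_smul_right (h : k[X]) (c : L) (u : HTwo k ⊗[k[X]] L) :
    P.extLeft (h • c) u = inclRightR k (tens 1 h) • P.extLeft c u := by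
  have h1 : comulLeftH k (tens 1 h) = inclRightR k (tens 1 h) := HThree.ext_eval fun a b c => by
    simp [evalThree_comulLeftH, evalThree_inclRightR]
  induction u with
  | zero => simp
  | tmul f a =>
    rw [extLeft_tmul, extLeft_tmul, ρ_smul_right, rTensor_smul, h1, smul_comm]
  | add u v hu hv => rw [map_add, map_add, hu, hv, smul_add]

theorem extRight_smul_right (h : k[X]) (c : L) (u : HTwo k ⊗[k[X]] L) :
    P.extRight (h • c) u = inclLeftR k (tens h 1) • P.extRight c u := by
  have h1 : comulRightH k (tens h 1) = inclLeftR k (tens h 1) := HThree.ext_eval fun a b c => by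
    simp [evalThree_comulRightH, evalThree_inclLeftR]
  induction u with
  | zero => simp
  | tmul f a =>
    rw [extRight_tmul, extRight_tmul, ρ_smul_left, rTensor_smul, h1, smul_comm]
  | add u v hu hv => rw [map_add, map_add, hu, hv, smul_add]

theorem jacobiator_smul_left (h : k[X]) (a b c : L) :
    P.jacobiator (h • a) b c = inclLeftR k (tens h 1) • P.jacobiator a b c := by
  have h1 : swapThreeH k (inclRightR k (tens h 1)) = inclLeftR k (tens h 1) :=
    HThree.ext_eval fun a b c => by
      simp [evalThree_swapThreeH, evalThree_inclLeftR, evalThree_inclRightR]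
  simp only [jacobiator, ρ_smul_left, extLeft_smul, extRight_smul, extRight_smul_right,
    rTensor_smul, h1, smul_sub]

theorem jacobiator_smul_mid (h : k[X]) (a b c : L) :
    P.jacobiator a (h • b) c = inclLeftR k (tens 1 h) • P.jacobiator a b c := by
  have h1 : swapThreeH k (inclLeftR k (tens h 1)) = inclLeftR k (tens 1 h) :=
    HThree.ext_eval fun a b c => by
      simp [evalThree_swapThreeH, evalThree_inclLeftR]
  have h2 : inclRightR k (tens h 1) = inclLeftR k (tens 1 h) :=
    HThree.ext_eval fun a b c => by
      simp [evalThree_inclRightR, evalThree_inclLeftR]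
  simp only [jacobiator, ρ_smul_left, ρ_smul_right, extLeft_smul, extRight_smul,
    extRight_smul_right, rTensor_smul, h1, h2, smul_sub]

theorem jacobiator_smul_right (h : k[X]) (a b c : L) :
    P.jacobiator a b (h • c) = inclRightR k (tens 1 h) • P.jacobiator a b c := by
  have h1 : swapThreeH k (inclRightR k (tens 1 h)) = inclRightR k (tens 1 h) :=
    HThree.ext_eval fun a b c => by
      simp [evalThree_swapThreeH, evalThree_inclRightR]
  simp only [jacobiator, ρ_smul_right, extLeft_smul_right, extRight_smul,
    rTensor_smul, h1, smul_sub]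

/-- The Jacobiator is additive in each argument, and a scalar `h` in the `i`-th argument comes out
as `h` in the `i`-th tensor factor of `H ⊗ H ⊗ H`. -/
theorem isLeibniz_iff_basis {ι : Type*} (e : Module.Basis ι k[X] L) :
    P.IsLeibniz ↔ ∀ i j l, P.jacobiator (e i) (e j) (e l) = 0 := by
  rw [isLeibniz_iff_jacobiator]
  refine ⟨fun h i j l => h _ _ _, fun h a b c => ?_⟩
  have zl : ∀ b c, P.jacobiator 0 b c = 0 := by simp [jacobiator,
    show P.extRight 0 = 0 from AddMonoidHom.ext fun u => by
      simpa using P.extRight_add 0 0 u]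
  have zm : ∀ a c, P.jacobiator a 0 c = 0 := by simp [jacobiator,
    show P.extRight 0 = 0 from AddMonoidHom.ext fun u => by
      simpa using P.extRight_add 0 0 u]
  have zr : ∀ a b, P.jacobiator a b 0 = 0 := by simp [jacobiator,
    show P.extLeft 0 = 0 from AddMonoidHom.ext fun u => by
      simpa using P.extLeft_add 0 0 u]
  refine basis_induction e (p := fun a => P.jacobiator a b c = 0) (fun i => ?_)
    (fun a a' h h' => by rw [jacobiator_add_left, h, h', add_zero])
    (fun r a h => by rw [jacobiator_smul_left, h, smul_zero]) (zl _ _) a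
  refine basis_induction e (p := fun b => P.jacobiator (e i) b c = 0) (fun j => ?_)
    (fun a a' h h' => by rw [jacobiator_add_mid, h, h', add_zero])
    (fun r a h => by rw [jacobiator_smul_mid, h, smul_zero]) (zm _ _) b
  exact basis_induction e (p := fun c => P.jacobiator (e i) (e j) c = 0) (fun l => h i j l)
    (fun a a' h h' => by rw [jacobiator_add_right, h, h', add_zero])
    (fun r a h => by rw [jacobiator_smul_right, h, smul_zero]) (zr _ _) c

/-- The defect of skew-commutativity. -/
def skewDefect (a b : L) : HTwo k ⊗[k[X]] L :=
  P.ρ a b + (swapTwoH k).toLinearMap.rTensor L (P.ρ b a)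

theorem skew_iff_basis {ι : Type*} (e : Module.Basis ι k[X] L) :
    (∀ a b, P.ρ a b = -((swapTwoH k).toLinearMap.rTensor L (P.ρ b a))) ↔
      ∀ i j, P.skewDefect (e i) (e j) = 0 := by
  simp only [← add_eq_zero_iff_eq_neg]
  change (∀ a b, P.skewDefect a b = 0) ↔ _
  have h1 (h : k[X]) : swapTwoH k (tens h 1) = tens 1 h := HTwo.ext_eval fun a b => by
    simp [evalTwo_swapTwoH]
  have h2 (h : k[X]) : swapTwoH k (tens 1 h) = tens h 1 := HTwo.ext_eval fun a b => by
    simp [evalTwo_swapTwoH]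
  refine ⟨fun h i j => h _ _, fun h a b => ?_⟩
  refine basis_induction e (p := fun a => P.skewDefect a b = 0) (fun i => ?_)
    (fun a a' h h' => ?_) (fun r a h => ?_) (by simp [skewDefect]) a
  · refine basis_induction e (p := fun b => P.skewDefect (e i) b = 0) (fun j => h i j)
      (fun a a' h h' => ?_) (fun r a h => ?_) (by simp [skewDefect]) b
    · refine Eq.trans ?_ ((congrArg₂ (· + ·) h h').trans (add_zero _))
      simp only [skewDefect, map_add, AddMonoidHom.add_apply]
      abel
    · refine Eq.trans ?_ ((congrArg (tens 1 r • ·) h).trans (smul_zero _))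
      simp only [skewDefect, ρ_smul_left, ρ_smul_right, rTensor_smul, h1, smul_add]
  · refine Eq.trans ?_ ((congrArg₂ (· + ·) h h').trans (add_zero _))
    simp only [skewDefect, map_add, AddMonoidHom.add_apply]
    abel
  · refine Eq.trans ?_ ((congrArg (tens r 1 • ·) h).trans (smul_zero _))
    simp only [skewDefect, ρ_smul_left, ρ_smul_right, rTensor_smul, h2, smul_add]

end Basic

/-! ### The Lie axioms as functional equations for structure constants. -/

section StructureConstants

variable {ι : Type*} [Fintype ι] (e : Module.Basis ι k[X] L)

/-- The pseudoproduct with prescribed values on a basis. -/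
def ofBasis (b : ι → ι → HTwo k ⊗[k[X]] L) : Pseudoalgebra k L where
  ρ := AddMonoidHom.mk'
    (fun a => AddMonoidHom.mk'
      (fun a' => ∑ i, ∑ j, tens (e.repr a i) (e.repr a' j) • b i j)
      (fun a' a'' => by
        simp only [map_add, Finsupp.add_apply, ← Finset.sum_add_distrib, ← add_smul]
        refine Finset.sum_congr rfl fun i _ => Finset.sum_congr rfl fun j _ => ?_
        exact congrArg (· • b i j) (TensorProduct.tmul_add _ _ _)))
    (fun a a' => by
      ext a''
      simp only [AddMonoidHom.mk'_apply, AddMonoidHom.add_apply, map_add, Finsupp.add_apply,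
        ← Finset.sum_add_distrib, ← add_smul]
      refine Finset.sum_congr rfl fun i _ => Finset.sum_congr rfl fun j _ => ?_
      exact congrArg (· • b i j) (TensorProduct.add_tmul _ _ _))
  smul_smul' h₁ h₂ a₁ a₂ := by
    simp [Finset.smul_sum, smul_smul, tens_mul_tens]

theorem ofBasis_apply (b : ι → ι → HTwo k ⊗[k[X]] L) (i j : ι) :
    (ofBasis e b).ρ (e i) (e j) = b i j := by
  classical
  change ∑ i', ∑ j', tens (e.repr (e i) i') (e.repr (e j) j') • b i' j' = b i j
  rw [Finset.sum_eq_single i, Finset.sum_eq_single j]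
  · simp [tens_one_one]
  · intro j' _ h
    simp [h.symm, tens_zero_right]
  · simp
  · intro i' _ h
    refine Finset.sum_eq_zero fun j' _ => ?_
    simp [h.symm, tens_zero_left]
  · simp

variable (P : Pseudoalgebra k L) (c : ι → ι → ι → HTwo k)

theorem extLeft_basis (hP : ∀ i j, P.ρ (e i) (e j) = ∑ n, c i j n ⊗ₜ e n) (i j l : ι) :
    P.extLeft (e l) (P.ρ (e i) (e j)) =
      ∑ m, (∑ n, inclLeftR k (c i j n) * comulLeftH k (c n l m)) ⊗ₜ e m := by
  simp only [hP, map_sum, extLeft_tmul, LinearMap.rTensor_tmul, Finset.smul_sum,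
    TensorProduct.smul_tmul', smul_eq_mul, TensorProduct.sum_tmul]
  exact Finset.sum_comm

theorem extRight_basis (hP : ∀ i j, P.ρ (e i) (e j) = ∑ n, c i j n ⊗ₜ e n) (i j l : ι) :
    P.extRight (e i) (P.ρ (e j) (e l)) =
      ∑ m, (∑ n, inclRightR k (c j l n) * comulRightH k (c i n m)) ⊗ₜ e m := by
  simp only [hP, map_sum, extRight_tmul, LinearMap.rTensor_tmul, Finset.smul_sum,
    TensorProduct.smul_tmul', smul_eq_mul, TensorProduct.sum_tmul]
  exact Finset.sum_comm

/-- The base change `A ⊗_H L` is free over `A` on the elements `1 ⊗ e m`. -/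
theorem sum_tmul_basis_eq_zero {A : Type*} [CommRing A] [Algebra k[X] A] (f : ι → A) :
    ∑ m, f m ⊗ₜ[k[X]] e m = 0 ↔ ∀ m, f m = 0 := by
  classical
  refine ⟨fun h m => ?_, fun h => by simp [h]⟩
  have h1 := congrArg (fun t => (e.baseChange A).repr t m) h
  simpa [Module.Basis.baseChange_repr_tmul, Finsupp.single_apply, Finset.sum_ite_eq'] using h1

variable [CharZero k]

theorem isLeibniz_iff_evalTwo (hP : ∀ i j, P.ρ (e i) (e j) = ∑ n, c i j n ⊗ₜ e n) :
    P.IsLeibniz ↔ ∀ i j l m, ∀ x y z : k,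
      ∑ n, evalTwo x y (c i j n) * evalTwo (x + y) z (c n l m) =
        ∑ n, evalTwo y z (c j l n) * evalTwo x (y + z) (c i n m) -
          ∑ n, evalTwo x z (c i l n) * evalTwo y (x + z) (c j n m) := by
  rw [P.isLeibniz_iff_basis e]
  refine forall_congr' fun i => forall_congr' fun j => forall_congr' fun l => ?_
  have h1 : P.jacobiator (e i) (e j) (e l) = ∑ m,
      ((∑ n, inclLeftR k (c i j n) * comulLeftH k (c n l m)) -
      ((∑ n, inclRightR k (c j l n) * comulRightH k (c i n m)) -
        swapThreeH k (∑ n, inclRightR k (c i l n) * comulRightH k (c j n m)))) ⊗ₜ e m := by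
    rw [jacobiator, extLeft_basis e P c hP, extRight_basis e P c hP, extRight_basis e P c hP]
    simp only [map_sum (LinearMap.rTensor L _), LinearMap.rTensor_tmul, TensorProduct.sub_tmul,
      Finset.sum_sub_distrib]
    rfl
  rw [h1, sum_tmul_basis_eq_zero]
  refine forall_congr' fun m => ?_
  rw [sub_eq_zero]
  constructor
  · intro h x y z
    have h2 := congrArg (evalThree x y z) h
    simpa only [map_sum, map_sub, map_mul, evalThree_swapThreeH, evalThree_inclLeftR,
      evalThree_inclRightR, evalThree_comulLeftH, evalThree_comulRightH] using h2
  · intro h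
    refine HThree.ext_eval fun x y z => ?_
    simpa only [map_sum, map_sub, map_mul, evalThree_swapThreeH, evalThree_inclLeftR,
      evalThree_inclRightR, evalThree_comulLeftH, evalThree_comulRightH] using h x y z

theorem skew_iff_evalTwo (hP : ∀ i j, P.ρ (e i) (e j) = ∑ n, c i j n ⊗ₜ e n) :
    (∀ a b, P.ρ a b = -((swapTwoH k).toLinearMap.rTensor L (P.ρ b a))) ↔
      ∀ i j m, ∀ x y : k, evalTwo x y (c i j m) = -evalTwo y x (c j i m) := by
  rw [P.skew_iff_basis e]
  refine forall_congr' fun i => forall_congr' fun j => ?_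
  have h1 : P.skewDefect (e i) (e j) = ∑ m, (c i j m + swapTwoH k (c j i m)) ⊗ₜ e m := by
    simp only [skewDefect, hP, map_sum, LinearMap.rTensor_tmul, TensorProduct.add_tmul,
      Finset.sum_add_distrib]
    rfl
  rw [h1, sum_tmul_basis_eq_zero]
  refine forall_congr' fun m => ?_
  constructor
  · intro h x y
    have h2 := congrArg (evalTwo x y) h
    rw [map_add, evalTwo_swapTwoH, map_zero] at h2
    exact eq_neg_of_add_eq_zero_left h2
  · intro h
    refine HTwo.ext_eval fun x y => ?_
    rw [map_add, evalTwo_swapTwoH, h, map_zero, neg_add_cancel]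

end StructureConstants

end Pseudoalgebra

/-! ### The multiplication table on `e₀, e₁, e₂, e₃` and its identities. -/

section Table

/-- The structure constants of a Schrödinger-Virasoro pseudoalgebra in which `e₃` has zero
brackets with `e₁`, `e₂` and `e₃`. -/
def svTable {R : Type*} [Zero R] (α β₁ β₂ β₃ A η β₁' β₂' β₃' η' : R) :
    Fin 4 → Fin 4 → Fin 4 → R :=
  ![![![α, 0, 0, 0], ![0, β₁, 0, 0], ![0, 0, β₂, 0], ![0, 0, 0, β₃]],
    ![![0, β₁', 0, 0], ![0, 0, A, 0], ![0, 0, η, 0], 0],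
    ![![0, 0, β₂', 0], ![0, 0, η', 0], 0, 0],
    ![![0, 0, 0, β₃'], 0, 0, 0]]

theorem map_svTable {R S F : Type*} [Zero R] [Zero S] [FunLike F R S] [ZeroHomClass F R S]
    (φ : F) (α β₁ β₂ β₃ A η β₁' β₂' β₃' η' : R) (i j l : Fin 4) :
    φ (svTable α β₁ β₂ β₃ A η β₁' β₂' β₃' η' i j l) =
      svTable (φ α) (φ β₁) (φ β₂) (φ β₃) (φ A) (φ η) (φ β₁') (φ β₂') (φ β₃') (φ η') i j l := by
  fin_cases i <;> fin_cases j <;> fin_cases l <;> simp [svTable]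

variable {k : Type*} [Field k]

/-- The values of the structure constants. -/
def svValue (l₁ l₂ κ₁ κ₂ : k) (A : k → k → k) (a x y : k) : Fin 4 → Fin 4 → Fin 4 → k :=
  svTable (x - y) (l₁ * x - y + κ₁) (l₂ * x - y + κ₂) (-y) (A x y) a
    (-(l₁ * y - x + κ₁)) (-(l₂ * y - x + κ₂)) x (-a)

theorem svValue_skew (l₁ l₂ κ₁ κ₂ : k) (A : k → k → k) (a : k) (hA : ∀ x y, A x y = -A y x)
    (i j m : Fin 4) (x y : k) :
    svValue l₁ l₂ κ₁ κ₂ A a x y i j m = -svValue l₁ l₂ κ₁ κ₂ A a y x j i m := by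
  fin_cases i <;> fin_cases j <;> fin_cases m <;> simp [svValue, svTable, hA x y]

set_option maxHeartbeats 1000000 in
-- The only nontrivial conditions are `h₁` at `(0,1,1)`, `hl` and `hκ` at `(0,1,2)`, `h₃` at
-- `(1,1,1)`, and those at permutations of these triples. Everything else is a polynomial identity.
theorem svValue_jacobi (l₁ l₂ κ₁ κ₂ : k) (A : k → k → k) (a : k) (hA : ∀ x y, A x y = -A y x)
    (h₁ : ∀ x y z, (l₁ * x - y + κ₁) * A (x + y) z + (l₁ * x - z + κ₁) * A y (x + z) =
      (l₂ * x - y - z + κ₂) * A y z)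
    (hl : a * l₁ = 0) (hκ : a * κ₁ = 0) (h₃ : ∀ x y z, a * (A x y + A y z - A x z) = 0)
    (i j l m : Fin 4) (x y z : k) :
    ∑ n, svValue l₁ l₂ κ₁ κ₂ A a x y i j n * svValue l₁ l₂ κ₁ κ₂ A a (x + y) z n l m =
      ∑ n, svValue l₁ l₂ κ₁ κ₂ A a y z j l n * svValue l₁ l₂ κ₁ κ₂ A a x (y + z) i n m -
        ∑ n, svValue l₁ l₂ κ₁ κ₂ A a x z i l n * svValue l₁ l₂ κ₁ κ₂ A a y (x + z) j n m := by
  simp only [svValue, Fin.sum_univ_four]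
  fin_cases i <;> fin_cases j <;> fin_cases l <;> simp [svTable]
  all_goals fin_cases m
  all_goals simp only [Fin.isValue, Fin.zero_eta, Fin.mk_one, Fin.reduceFinMk, Matrix.cons_val,
    mul_zero, sub_zero, neg_zero, add_zero]
  all_goals first
    | ring1
    | linear_combination x * hl + hκ
    | linear_combination -y * hl - hκ
    | linear_combination y * hl + hκ
    | linear_combination z * hl + hκ
    | linear_combination -z * hl - hκ
    | linear_combination h₁ x y z
    -- `A` is an arbitrary function here, so sums inside its arguments have to be commuted
    -- explicitly.
    | linear_combination -h₁ y x z + (x - l₁ * y - κ₁) * congrArg (A · z) (add_comm x y)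
    | linear_combination -h₃ x y z
    | linear_combination h₁ z x y - (κ₁ + l₁ * z - y) * congrArg (A x) (add_comm z y) -
        (κ₁ + l₁ * z - x) * (congrArg (A · y) (add_comm z x) + hA (x + z) y)
    | linear_combination -x * hl - hκ

end Table

/-! ### From parameters to algebras, and from algebras to equations. -/

section

variable {k : Type*} [Field k]

@[simp]
theorem evalTwo_alpha (x y : k) : evalTwo x y (alpha k) = x - y := by
  simp [alpha]

@[simp]
theorem evalTwo_beta (l κ x y : k) : evalTwo x y (beta l κ) = l * x - y + κ := by
  simp [beta]

/-- The structure constants of a Schrödinger-Virasoro pseudoalgebra in which `e₃` has zero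
brackets with `e₁`, `e₂` and `e₃`, and weight `β₃ = -1 ⊗ s`. -/
def svCoeff (l₁ l₂ κ₁ κ₂ : k) (A η : HTwo k) : Fin 4 → Fin 4 → Fin 4 → HTwo k :=
  svTable (alpha k) (beta l₁ κ₁) (beta l₂ κ₂) (beta 0 0) A η (-swapTwoH k (beta l₁ κ₁))
    (-swapTwoH k (beta l₂ κ₂)) (-swapTwoH k (beta 0 0)) (-swapTwoH k η)

theorem evalTwo_svCoeff (l₁ l₂ κ₁ κ₂ : k) (A : HTwo k) (a x y : k) (i j m : Fin 4) :
    evalTwo x y (svCoeff l₁ l₂ κ₁ κ₂ A (a • tens 1 1) i j m) =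
      svValue l₁ l₂ κ₁ κ₂ (fun x y => evalTwo x y A) a x y i j m := by
  rw [svCoeff, map_svTable, svValue]
  congr 1 <;> simp [evalTwo_swapTwoH]

/-- This is closure of `He₀ ⊕ He₁ ⊕ He₂` under the bracket, so the rank-three algebra is read off
from the rank-four table. -/
theorem svCoeff_castSucc_last (l₁ l₂ κ₁ κ₂ : k) (A η : HTwo k) (i j : Fin 3) :
    svCoeff l₁ l₂ κ₁ κ₂ A η i.castSucc j.castSucc (Fin.last 3) = 0 := by
  fin_cases i <;> fin_cases j <;> simp [svCoeff, svTable, Fin.last]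

theorem isHom_of_basis {L M ι : Type*} [AddCommGroup L] [Module k[X] L] [AddCommGroup M]
    [Module k[X] M] (P : Pseudoalgebra k L) (Q : Pseudoalgebra k M) (e : Module.Basis ι k[X] L)
    (f : L →ₗ[k[X]] M)
    (h : ∀ i j, Q.ρ (f (e i)) (f (e j)) = f.lTensor (HTwo k) (P.ρ (e i) (e j))) :
    P.IsHom Q f := by
  have hs : ∀ (t : HTwo k) u, f.lTensor (HTwo k) (t • u) = t • f.lTensor (HTwo k) u := by
    intro t u
    induction u with
    | zero => simp
    | tmul x y => simp [TensorProduct.smul_tmul']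
    | add x y hx hy => simp only [smul_add, map_add, hx, hy]
  intro a b
  refine basis_induction e
    (p := fun a => Q.ρ (f a) (f b) = f.lTensor (HTwo k) (P.ρ a b)) (fun i => ?_)
    (fun a a' h h' => by simp only [map_add, AddMonoidHom.add_apply, h, h'])
    (fun r a h => by simp only [map_smul, Pseudoalgebra.ρ_smul_left, h, hs]) (by simp) a
  exact basis_induction e
    (p := fun b => Q.ρ (f (e i)) (f b) = f.lTensor (HTwo k) (P.ρ (e i) b)) (fun j => h i j)
    (fun a a' h h' => by simp only [map_add, h, h'])
    (fun r a h => by simp only [map_smul, Pseudoalgebra.ρ_smul_right, h, hs]) (by simp) b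

variable {L : Type*} [AddCommGroup L] [Module k[X] L]

theorem IsMType.ρ_basis {P : Pseudoalgebra k L} {e : Module.Basis (Fin 3) k[X] L} {m : ℕ}
    {l₁ l₂ κ₁ κ₂ : k} {A η : HTwo k} (h : IsMType P e m l₁ l₂ κ₁ κ₂ A η) (i j : Fin 3) :
    P.ρ (e i) (e j) =
      ∑ n : Fin 3, svCoeff l₁ l₂ κ₁ κ₂ A η i.castSucc j.castSucc n.castSucc ⊗ₜ e n := by
  have h10 : P.ρ (e 1) (e 0) = -swapTwoH k (beta l₁ κ₁) ⊗ₜ e 1 := by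
    rw [h.lie.skew, h.b01]
    rfl
  have h20 : P.ρ (e 2) (e 0) = -swapTwoH k (beta l₂ κ₂) ⊗ₜ e 2 := by
    rw [h.lie.skew, h.b02]
    rfl
  have h21 : P.ρ (e 2) (e 1) = -swapTwoH k η ⊗ₜ e 2 := by
    rw [h.lie.skew, h.b12]
    rfl
  fin_cases i <;> fin_cases j <;>
    simp [svCoeff, svTable, Fin.sum_univ_three, h10, h20, h21, h.b00, h.b01, h.b02, h.b11, h.b12,
      h.b22, TensorProduct.neg_tmul]

variable [CharZero k]

theorem exists_isMType_isSV (e : Module.Basis (Fin 3) k[X] L) (m : ℕ) (l₁ l₂ κ₁ κ₂ : k)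
    (A : HTwo k) (a : k) (hm : HasType m A) (hA : ∀ x y, evalTwo x y A = -evalTwo y x A)
    (h₁ : ∀ x y z, (l₁ * x - y + κ₁) * evalTwo (x + y) z A +
      (l₁ * x - z + κ₁) * evalTwo y (x + z) A = (l₂ * x - y - z + κ₂) * evalTwo y z A)
    (hl : a * l₁ = 0) (hκ : a * κ₁ = 0)
    (h₃ : ∀ x y z, a * (evalTwo x y A + evalTwo y z A - evalTwo x z A) = 0) :
    ∃ P : Pseudoalgebra k L, IsMType P e m l₁ l₂ κ₁ κ₂ A (a • tens 1 1) ∧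
      ∃ (Q : Pseudoalgebra k (Fin 4 → k[X])) (ι : L →ₗ[k[X]] (Fin 4 → k[X])),
        IsSV Q (Pi.basisFun k[X] (Fin 4)) m l₁ l₂ κ₁ κ₂ A (a • tens 1 1) ∧
        P.IsHom Q ι ∧ ∀ i : Fin 3, ι (e i) = Pi.basisFun k[X] (Fin 4) i.castSucc := by
  set c := svCoeff l₁ l₂ κ₁ κ₂ A (a • tens 1 1) with hc
  set f := Pi.basisFun k[X] (Fin 4) with hf
  have hskew : ∀ i j m, ∀ x y : k, evalTwo x y (c i j m) = -evalTwo y x (c j i m) := by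
    intro i j m x y
    rw [hc, evalTwo_svCoeff, evalTwo_svCoeff]
    exact svValue_skew _ _ _ _ _ _ hA i j m x y
  have hjac : ∀ i j l m, ∀ x y z : k,
      ∑ n, evalTwo x y (c i j n) * evalTwo (x + y) z (c n l m) =
        ∑ n, evalTwo y z (c j l n) * evalTwo x (y + z) (c i n m) -
          ∑ n, evalTwo x z (c i l n) * evalTwo y (x + z) (c j n m) := by
    intro i j l m x y z
    simp only [hc, evalTwo_svCoeff]
    exact svValue_jacobi _ _ _ _ _ _ hA h₁ hl hκ h₃ i j l m x y z
  have hlast : ∀ i j : Fin 3, c i.castSucc j.castSucc (Fin.last 3) = 0 :=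
    fun i j => svCoeff_castSucc_last _ _ _ _ _ _ i j
  let Q := Pseudoalgebra.ofBasis f fun i j => ∑ n, c i j n ⊗ₜ f n
  let P := Pseudoalgebra.ofBasis e fun i j =>
    ∑ n : Fin 3, c i.castSucc j.castSucc n.castSucc ⊗ₜ e n
  have hQ : ∀ i j, Q.ρ (f i) (f j) = ∑ n, c i j n ⊗ₜ f n := Pseudoalgebra.ofBasis_apply f _
  have hP : ∀ i j, P.ρ (e i) (e j) = ∑ n : Fin 3, c i.castSucc j.castSucc n.castSucc ⊗ₜ e n :=
    Pseudoalgebra.ofBasis_apply e _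
  have hQL : Q.IsLie :=
    ⟨(Pseudoalgebra.isLeibniz_iff_evalTwo f Q c hQ).2 hjac,
      (Pseudoalgebra.skew_iff_evalTwo f Q c hQ).2 hskew⟩
  have hPL : P.IsLie := by
    refine ⟨(Pseudoalgebra.isLeibniz_iff_evalTwo e P
      (fun i j n => c i.castSucc j.castSucc n.castSucc) hP).2 ?_,
      (Pseudoalgebra.skew_iff_evalTwo e P
      (fun i j n => c i.castSucc j.castSucc n.castSucc) hP).2 fun _ _ _ => hskew _ _ _⟩
    intro i j l m x y z
    -- The summand through `e₃` vanishes, so the four-term Jacobi sums are already the three-term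
    -- ones.
    simpa only [Fin.sum_univ_castSucc (n := 3), hlast, map_zero, zero_mul, add_zero] using
      hjac i.castSucc j.castSucc l.castSucc m.castSucc x y z
  refine ⟨P, ⟨hPL, hm, ?_, ?_, ?_, ?_, ?_, ?_⟩, Q, e.constr k[X] fun i => f i.castSucc,
    ⟨hQL, hm, ?_, ?_, ?_, ⟨0, 0, ?_⟩, ?_, ?_, ⟨0, 0, ?_⟩, ⟨0, 0, ?_⟩, ?_, ?_⟩, ?_, ?_⟩
  iterate 6 simp [hP, hc, svCoeff, svTable, Fin.sum_univ_three]
  iterate 10 simp [hQ, hc, svCoeff, svTable, Fin.sum_univ_four]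
  · refine isHom_of_basis P Q e _ fun i j => ?_
    simp only [Module.Basis.constr_basis, hP, hQ, map_sum, LinearMap.lTensor_tmul,
      Fin.sum_univ_castSucc (n := 3), hlast, TensorProduct.zero_tmul, add_zero]
  · exact fun i => e.constr_basis _ _ _

/-- Skew-symmetry at `(1,1)` and the `e₂`-components of Jacobi at `(0,1,1)`, `(0,1,2)`, `(1,1,1)`,
`(1,1,2)`. These alone determine the classification. -/
theorem IsMType.evalTwo_equations {P : Pseudoalgebra k L} {e : Module.Basis (Fin 3) k[X] L} {m : ℕ}
    {l₁ l₂ κ₁ κ₂ : k} {A η : HTwo k} (h : IsMType P e m l₁ l₂ κ₁ κ₂ A η) :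
    (∀ x y, evalTwo x y A = -evalTwo y x A) ∧
    (∀ x y z, (l₁ * x - y + κ₁) * evalTwo (x + y) z A +
      (l₁ * x - z + κ₁) * evalTwo y (x + z) A = (l₂ * x - y - z + κ₂) * evalTwo y z A) ∧
    (∀ x y z, (l₁ * x - y + κ₁) * evalTwo (x + y) z η =
      (l₂ * x - y - z + κ₂) * evalTwo y z η - (l₂ * x - z + κ₂) * evalTwo y (x + z) η) ∧
    (∀ x y z, -(evalTwo x y A * evalTwo z (x + y) η) =
      evalTwo y z A * evalTwo x (y + z) η - evalTwo x z A * evalTwo y (x + z) η) ∧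
    ∀ x y z, evalTwo y z η * evalTwo x (y + z) η = evalTwo x z η * evalTwo y (x + z) η := by
  have hj := (Pseudoalgebra.isLeibniz_iff_evalTwo e P _ h.ρ_basis).1 h.lie.jacobi
  have hs := (Pseudoalgebra.skew_iff_evalTwo e P _ h.ρ_basis).1 h.lie.skew
  have hs := hs 1 1 2
  have h1 := hj 0 1 1 2
  have h2 := hj 0 1 2 2
  have h3 := hj 1 1 1 2
  have h4 := hj 1 1 2 2
  simp [svCoeff, svTable, Fin.sum_univ_three, evalTwo_swapTwoH] at hs h1 h2 h3 h4
  refine ⟨hs, fun x y z => ?_, fun x y z => ?_, fun x y z => ?_, fun x y z => ?_⟩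
  · linear_combination h1 x y z
  · linear_combination h2 x y z
  · linear_combination h3 x y z
  · linear_combination -h4 x y z

end

/-! ### Solving the equation for `α'`: translation and coefficient recursion. -/

section

variable {k : Type*} [Field k]

/-- The translation `s ⊗ 1 ↦ (s + κ) ⊗ 1`, `1 ⊗ s ↦ 1 ⊗ (s + κ)`. -/
def translate (κ : k) : HTwo k →ₐ[k] HTwo k :=
  Algebra.TensorProduct.map (Polynomial.aeval (Polynomial.X + Polynomial.C κ))
    (Polynomial.aeval (Polynomial.X + Polynomial.C κ))

theorem evalTwo_translate (κ x y : k) (t : HTwo k) :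
    evalTwo x y (translate κ t) = evalTwo (x + κ) (y + κ) t := by
  have : (evalTensorTwo x y).comp (Algebra.TensorProduct.map
      (Polynomial.aeval (Polynomial.X + Polynomial.C κ))
      (Polynomial.aeval (Polynomial.X + Polynomial.C κ))) = evalTensorTwo (x + κ) (y + κ) := by
    ext <;> simp [evalTensorTwo]
  exact DFunLike.congr_fun this t

variable [CharZero k]

theorem coeffTwo_asym (i j p q : ℕ) : coeffTwo i j (asym k p q) =
    (if i = p ∧ j = q then 1 else 0) - (if i = q ∧ j = p then 1 else 0) := by
  rw [asym, map_sub, coeffTwo_monom, coeffTwo_monom]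

/-- The recursion satisfied by the coefficients of `α'` when `κ₁ = κ₂ = 0`. -/
structure CoeffRecursion (g : ℕ → ℕ → k) (l₁ l₂ : k) : Prop where
  skew : ∀ i j, g i j = -g j i
  degree : ∀ i j, (2 * l₁ - l₂ - i - j) * g i j = 0
  step : ∀ n i j : ℕ, 1 ≤ n →
    ((n + 1) * l₁ - i) * g (n + i) j + ((n + 1) * l₁ - j) * g i (n + j) = 0

namespace CoeffRecursion

variable {g : ℕ → ℕ → k} {l₁ l₂ : k} (h : CoeffRecursion g l₁ l₂)
include h

theorem diag (i : ℕ) : g i i = 0 := by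
  have h1 := h.skew i i
  have h2 : 2 * g i i = 0 := by linear_combination h1
  simpa using h2

theorem support {p q : ℕ} (hpq : g p q ≠ 0) :
    l₂ = 2 * l₁ - (p + q : ℕ) ∧ ∀ i j, i + j ≠ p + q → g i j = 0 := by
  have h1 := (mul_eq_zero.1 (h.degree p q)).resolve_right hpq
  refine ⟨by push_cast; linear_combination -h1, fun i j hij => ?_⟩
  refine (mul_eq_zero.1 (h.degree i j)).resolve_left fun h2 => hij ?_
  have h3 : ((i + j : ℕ) : k) = (p + q : ℕ) := by push_cast; linear_combination h1 - h2
  exact_mod_cast h3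

/-- The recursion with `i = 0` expresses every `g n j` through `g 0 d`. Skew-symmetry between `(1,
d-1)` and `(d-1, 1)`, and between `(2, d-2)` and `(d-2, 2)`, then gives two linear equations for
`l₁`. -/
theorem degree_of_ne_zero (hl : l₁ ≠ 0) {d : ℕ} (hd : ∀ i j, i + j ≠ d → g i j = 0)
    {p q : ℕ} (hpq : g p q ≠ 0) : g 0 d ≠ 0 ∧
      (d = 1 ∨ (d = 2 ∧ l₁ = 1 / 2) ∨ (d = 3 ∧ l₁ = 2 / 3 ∧ g 1 2 = 1 / 2 * g 0 3)) := by
  have hrow : ∀ n j : ℕ, 1 ≤ n → n + j = d →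
      (n + 1) * l₁ * g n j = -((n + 1) * l₁ - j) * g 0 d := by
    intro n j hn hnj
    have h1 := h.step n 0 j hn
    rw [hnj] at h1
    push_cast at h1
    linear_combination h1
  have h0 : g 0 d ≠ 0 := by
    intro h0
    have hp : p + q = d := by
      by_contra hne
      exact hpq (hd p q hne)
    rcases Nat.eq_zero_or_pos p with rfl | hp'
    · rw [zero_add] at hp
      exact hpq (hp ▸ h0)
    · have h1 := hrow p q hp' hp
      rw [h0, mul_zero] at h1
      have h2 : ((p : k) + 1) ≠ 0 := by exact_mod_cast p.succ_ne_zero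
      exact hpq ((mul_eq_zero.1 h1).resolve_left (mul_ne_zero h2 hl))
  refine ⟨h0, ?_⟩
  obtain _ | _ | _ | d := d
  · exact absurd (h.diag 0) h0
  · exact Or.inl rfl
  · have h1 := hrow 1 1 le_rfl rfl
    rw [h.diag 1] at h1
    push_cast at h1
    have h2 : (2 * l₁ - 1) * g 0 2 = 0 := by linear_combination h1
    have h3 := (mul_eq_zero.1 h2).resolve_right h0
    exact Or.inr (Or.inl ⟨rfl, by linear_combination h3 / 2⟩)
  · have a1 := hrow 1 (d + 2) le_rfl (by ring)
    have a2 := hrow (d + 2) 1 (by omega) (by ring)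
    have b1 := hrow 2 (d + 1) (by omega) (by ring)
    have b2 := hrow (d + 1) 2 (by omega) (by ring)
    rw [h.skew (d + 2) 1] at a2
    rw [h.skew (d + 1) 2] at b2
    push_cast at a1 a2 b1 b2
    have a3 : (4 * (d + 3) * l₁ - (d + 3) * (d + 2) - 2) * g 0 (d + 1 + 1 + 1) = 0 := by
      linear_combination (d + 3 : k) * a1 + 2 * a2
    have b3 : (6 * (d + 2) * l₁ - (d + 2) * (d + 1) - 6) * g 0 (d + 1 + 1 + 1) = 0 := by
      linear_combination (d + 2 : k) * b1 + 3 * b2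
    have a4 := (mul_eq_zero.1 a3).resolve_right h0
    have b4 := (mul_eq_zero.1 b3).resolve_right h0
    -- Eliminating `l₁` from the two equations. The degree is now `d + 3`, so `d = 0` means degree
    -- three.
    have h5 : (d : k) * ((d + 4) * (d + 5)) = 0 := by
      linear_combination -3 * (d + 2 : k) * a4 + 2 * (d + 3) * b4
    have h6 : d * ((d + 4) * (d + 5)) = 0 := by exact_mod_cast h5
    have h7 : d = 0 := by simpa using h6
    subst h7
    push_cast at a4 a1
    have h8 : l₁ = 2 / 3 := by linear_combination a4 / 12
    refine Or.inr (Or.inr ⟨rfl, h8, ?_⟩)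
    rw [h8] at a1
    simp only [zero_add] at a1
    linear_combination 3 / 4 * a1

/-- For `l₁ = 0` the row `i = 0` of the recursion kills `g 0 d` once `d ≥ 2`, and the row `i = 1`
expresses the rest through `g 1 (d-1)`. Degree two dies because `g 1 1 = 0`; from degree four on,
skew-symmetry between `(2, d-2)` and `(d-2, 2)` leaves nothing. -/
theorem degree_of_eq_zero (hl : l₁ = 0) {d : ℕ} (hd : ∀ i j, i + j ≠ d → g i j = 0)
    {p q : ℕ} (hpq : g p q ≠ 0) : (d = 1 ∧ g 0 1 ≠ 0) ∨ (d = 3 ∧ g 0 3 = 0 ∧ g 1 2 ≠ 0) := by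
  subst hl
  have hp : p + q = d := by
    by_contra hne
    exact hpq (hd p q hne)
  obtain _ | _ | d := d
  · obtain ⟨rfl, rfl⟩ : p = 0 ∧ q = 0 := by omega
    exact absurd (h.diag 0) hpq
  · refine Or.inl ⟨rfl, fun h0 => hpq ?_⟩
    obtain ⟨rfl, rfl⟩ | ⟨rfl, rfl⟩ : (p = 0 ∧ q = 1) ∨ (p = 1 ∧ q = 0) := by omega
    · exact h0
    · rw [h.skew, h0, neg_zero]
  · have h0 : g 0 (d + 2) = 0 := by
      have h1 := h.step 1 0 (d + 1) le_rfl
      push_cast at h1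
      have h2 : ((d : k) + 1) * g 0 (1 + (d + 1)) = 0 := by linear_combination -h1
      have h3 : ((d : k) + 1) ≠ 0 := by exact_mod_cast d.succ_ne_zero
      rw [show d + 2 = 1 + (d + 1) by ring]
      exact (mul_eq_zero.1 h2).resolve_left h3
    have hrow : ∀ n j : ℕ, 1 ≤ n → n + j = d + 1 → g (n + 1) j = -j * g 1 (d + 1) := by
      intro n j hn hnj
      have h1 := h.step n 1 j hn
      rw [hnj] at h1
      push_cast at h1
      linear_combination -h1
    have h1 : g 1 (d + 1) ≠ 0 := by
      intro h1
      apply hpq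
      obtain _ | _ | p := p
      · rw [zero_add] at hp
        rw [hp]
        exact h0
      · rw [show q = d + 1 by omega, h1]
      · rw [hrow (p + 1) q (by omega) (by omega), h1, mul_zero]
    obtain _ | _ | d := d
    · exact absurd (h.diag 1) h1
    · exact Or.inr ⟨rfl, h0, h1⟩
    · exfalso
      have a1 := hrow 1 (d + 2) le_rfl (by ring)
      have a2 := hrow (d + 1) 2 (by omega) (by ring)
      rw [h.skew] at a2
      push_cast at a1 a2
      have a3 : ((d : k) + 4) * g 1 (d + 1 + 1 + 1) = 0 := by
        linear_combination a1 + a2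
      have a4 : ((d : k) + 4) ≠ 0 := by exact_mod_cast (d + 3).succ_ne_zero
      exact h1 ((mul_eq_zero.1 a3).resolve_left a4)

end CoeffRecursion

theorem coeffRecursion_of_evalTwo {G : HTwo k} {l₁ l₂ : k}
    (hG : ∀ x y, evalTwo x y G = -evalTwo y x G)
    (h : ∀ x y z, (l₁ * x - y) * evalTwo (x + y) z G + (l₁ * x - z) * evalTwo y (x + z) G =
      (l₂ * x - y - z) * evalTwo y z G) :
    CoeffRecursion (fun i j => coeffTwo i j G) l₁ l₂ := by
  set X := inclLeftR k (tens Polynomial.X 1) with hX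
  set Y := inclLeftR k (tens 1 Polynomial.X) with hY
  set Z := inclRightR k (tens 1 Polynomial.X) with hZ
  have hsk : G = -swapTwoH k G := HTwo.ext_eval fun x y => by
    rw [map_neg, evalTwo_swapTwoH, hG]
  -- The functional equation is lifted to an identity in `H ⊗ H ⊗ H`, whose coefficients can then be
  -- compared.
  have heq : l₁ • (X * comulLeftH k G) - Y * comulLeftH k G +
      (l₁ • (X * swapThreeH k (comulRightH k G)) - Z * swapThreeH k (comulRightH k G)) =
      l₂ • (X * inclRightR k G) - Y * inclRightR k G - Z * inclRightR k G := by
    refine HThree.ext_eval fun x y z => ?_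
    simp only [map_add, map_sub, map_smul, map_mul, evalThree_comulLeftH, evalThree_swapThreeH,
      evalThree_comulRightH, evalThree_inclLeftR, evalThree_inclRightR, hX, hY, hZ, evalTwo_tens,
      Polynomial.eval_X, Polynomial.eval_one, smul_eq_mul]
    linear_combination h x y z
  have hc : ∀ n i j : ℕ, (((n : k) + 1) * l₁ - i) * coeffTwo (n + i) j G +
      ((n + 1) * l₁ - j) * coeffTwo i (n + j) G =
        if n = 0 then l₂ * coeffTwo i j G else 0 := by
    intro n i j
    -- The index is `n + 1` because multiplication by `X` lowers it by one; the factor `n + 1` this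
    -- produces enters the recursion. Only `n = 0` sees the term with `l₂`, and it gives
    -- homogeneity.
    have h1 := congrArg (coeffThree (n + 1) i j) heq
    simp only [map_add, map_sub, map_smul, hX, hY, hZ, coeffThree_fst_mul, coeffThree_snd_mul,
      coeffThree_trd_mul, coeffThree_comulLeftH, coeffThree_swapThreeH_comulRightH,
      coeffThree_inclRightR, smul_eq_mul, Nat.add_sub_cancel, Nat.cast_add, Nat.cast_one] at h1
    have h2 : (i : k) * coeffTwo (n + 1 + (i - 1)) j G = i * coeffTwo (n + i) j G := by
      cases i with
      | zero => simp
      | succ i => rw [show n + 1 + (i + 1 - 1) = n + (i + 1) by omega]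
    have h3 : (j : k) * coeffTwo i (n + 1 + (j - 1)) G = j * coeffTwo i (n + j) G := by
      cases j with
      | zero => simp
      | succ j => rw [show n + 1 + (j + 1 - 1) = n + (j + 1) by omega]
    rw [h2, h3] at h1
    simp only [Nat.add_eq_zero_iff, one_ne_zero, and_false, if_false, mul_zero, sub_zero] at h1
    split_ifs at h1 ⊢ with hn
    · subst hn
      simp only [Nat.cast_zero, zero_add] at h1 ⊢
      linear_combination h1
    · linear_combination h1
  refine ⟨fun i j => ?_, fun i j => ?_, fun n i j hn => ?_⟩
  · conv_lhs => rw [hsk]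
    rw [map_neg, coeffTwo_swapTwoH]
  · have h1 := hc 0 i j
    simp only [Nat.cast_zero, zero_add, if_true] at h1
    linear_combination h1
  · rw [hc, if_neg (by omega)]

/-- A nonzero coefficient fixes the degree `p + q`; in each admissible degree the surviving
coefficients form a line, spanned by the displayed tensor. -/
theorem CoeffRecursion.eq_asym {G : HTwo k} {l₁ l₂ : k}
    (h : CoeffRecursion (fun i j => coeffTwo i j G) l₁ l₂) (hG : G ≠ 0) :
    ∃ w : k, w ≠ 0 ∧
      ((l₂ = 2 * l₁ - 1 ∧ G = w • asym k 0 1) ∨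
      (l₁ = 1 / 2 ∧ l₂ = -1 ∧ G = w • asym k 0 2) ∨
      (l₁ = 0 ∧ l₂ = -3 ∧ G = w • asym k 1 2) ∨
      (l₁ = 2 / 3 ∧ l₂ = -(5 / 3) ∧ G = w • (asym k 0 3 + (1 / 2 : k) • asym k 1 2))) := by
  obtain ⟨p, q, hpq⟩ : ∃ p q, coeffTwo p q G ≠ 0 := by
    by_contra! h0
    exact hG (HTwo.ext_coeff fun i j => by rw [h0, map_zero])
  obtain ⟨hl₂, hd⟩ := h.support hpq
  replace hd : ∀ i j, i + j ≠ p + q → coeffTwo i j G = 0 := hd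
  have hsk : ∀ i j, coeffTwo i j G = -coeffTwo j i G := h.skew
  have hdiag : ∀ i, coeffTwo i i G = 0 := h.diag
  have key : ∀ d, p + q = d → ∀ T : HTwo k,
      (∀ i j, i + j ≠ d → coeffTwo i j T = 0) → (∀ i ≤ d, coeffTwo i (d - i) G =
        coeffTwo i (d - i) T) → G = T := by
    intro d hpd T hT hGT
    refine HTwo.ext_coeff fun i j => ?_
    by_cases hij : i + j = d
    · have := hGT i (by omega)
      rwa [show d - i = j by omega] at this
    · rw [hT i j hij, hd i j (by omega)]
  have hz : ∀ a b d i j : ℕ, a + b = d → i + j ≠ d → coeffTwo i j (asym k a b) = 0 := by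
    intro a b d i j hab hij
    rw [coeffTwo_asym, if_neg (by omega), if_neg (by omega), sub_zero]
  have hB : ∀ w, p + q = 1 → coeffTwo 0 1 G = w → G = w • asym k 0 1 := by
    intro w hpq hw
    refine key 1 hpq _ (fun i j hij => ?_) fun i hi => ?_
    · rw [map_smul, hz 0 1 1 i j rfl hij, smul_zero]
    · interval_cases i
      · simp [coeffTwo_asym, hw]
      · simp [coeffTwo_asym, hsk 1 0, hw]
  by_cases hl : l₁ = 0
  · obtain ⟨h1, h0⟩ | ⟨h1, h0, h2⟩ := h.degree_of_eq_zero hl hd hpq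
    · exact ⟨_, h0, Or.inl ⟨by rw [hl₂, h1, Nat.cast_one], hB _ h1 rfl⟩⟩
    · refine ⟨_, h2, Or.inr (Or.inr (Or.inl ⟨hl, by rw [hl₂, h1, hl]; norm_num, ?_⟩))⟩
      refine key 3 h1 _ (fun i j hij => ?_) fun i hi => ?_
      · rw [map_smul, hz 1 2 3 i j rfl hij, smul_zero]
      · interval_cases i
        · simp [coeffTwo_asym, h0]
        · simp [coeffTwo_asym]
        · simp [coeffTwo_asym, hsk 2 1]
        · simp [coeffTwo_asym, hsk 3 0, h0]
  · obtain ⟨h0, h1 | ⟨h1, h2⟩ | ⟨h1, h2, h3⟩⟩ := h.degree_of_ne_zero hl hd hpq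
    · rw [h1] at h0
      exact ⟨_, h0, Or.inl ⟨by rw [hl₂, h1, Nat.cast_one], hB _ h1 rfl⟩⟩
    · rw [h1] at h0
      refine ⟨_, h0, Or.inr (Or.inl ⟨h2, by rw [hl₂, h1, h2]; norm_num, ?_⟩)⟩
      refine key 2 h1 _ (fun i j hij => ?_) fun i hi => ?_
      · rw [map_smul, hz 0 2 2 i j rfl hij, smul_zero]
      · interval_cases i
        · simp [coeffTwo_asym]
        · simp [coeffTwo_asym, hdiag]
        · simp [coeffTwo_asym, hsk 2 0]
    · rw [h1] at h0
      refine ⟨_, h0, Or.inr (Or.inr (Or.inr ⟨h2, by rw [hl₂, h1, h2]; norm_num, ?_⟩))⟩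
      refine key 3 h1 _ (fun i j hij => ?_) fun i hi => ?_
      · rw [map_smul, map_add, map_smul, hz 0 3 3 i j rfl hij, hz 1 2 3 i j rfl hij, smul_zero,
          add_zero, smul_zero]
      · interval_cases i
        · simp [coeffTwo_asym]
        · simp [coeffTwo_asym, h3, mul_comm]
        · simp [coeffTwo_asym, hsk 2 1, h3, mul_comm]
        · simp [coeffTwo_asym, hsk 3 0]

end

/-! ### Solving the equations for `η`. -/

section

variable {k : Type*} [Field k]

section Taylor

theorem coeff_taylor_sub {f : k[X]} {p : ℕ} (hf : f.natDegree = p + 1) (y : k) :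
    (Polynomial.taylor y f - f).coeff p = (p + 1) * y * f.leadingCoeff := by
  have h1 : (Polynomial.hasseDeriv p f).natDegree < 2 := by
    have := Polynomial.natDegree_hasseDeriv_le f p
    omega
  rw [Polynomial.coeff_sub, Polynomial.taylor_coeff, Polynomial.eval_eq_sum_range' h1,
    Finset.sum_range_succ, Finset.sum_range_one, Polynomial.hasseDeriv_coeff,
    Polynomial.hasseDeriv_coeff, Polynomial.leadingCoeff, hf, add_comm 1 p]
  simp
  ring

theorem natDegree_taylor_sub_le {f : k[X]} {p : ℕ} (hf : f.natDegree = p + 1) (y : k) :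
    (Polynomial.taylor y f - f).natDegree ≤ p := by
  have h0 : f ≠ 0 := by
    rintro rfl
    simp at hf
  have h1 : (Polynomial.taylor y f - f).degree < (Polynomial.taylor y f).degree :=
    Polynomial.degree_sub_lt_left (Polynomial.degree_taylor _ _)
      (by simpa [Polynomial.taylor_eq_zero] using h0) (Polynomial.leadingCoeff_taylor _ _)
  rw [Polynomial.degree_taylor, Polynomial.degree_eq_natDegree h0, hf] at h1
  exact Polynomial.natDegree_le_iff_coeff_eq_zero.2 fun N hN =>
    Polynomial.coeff_eq_zero_of_degree_lt (h1.trans_le (by exact_mod_cast hN))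

/-- Subtracting `f g` from both sides gives `g · (f(X + y) - f) = f · (g(X + x) - g)`. The
coefficients in degree `deg f + deg g - 1` are `deg f · y` and `deg g · x` times the product of the
leading coefficients. Constant `f` or `g` is treated apart, its difference being zero. -/
theorem natDegree_mul_eq_of_taylor {f g : k[X]} (hf : f ≠ 0) (hg : g ≠ 0) {x y : k}
    (h : g * Polynomial.taylor y f = f * Polynomial.taylor x g) :
    (f.natDegree : k) * y = g.natDegree * x := by
  have h1 : g * (Polynomial.taylor y f - f) = f * (Polynomial.taylor x g - g) := by
    rw [mul_sub, h, mul_sub, mul_comm g f]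
  have hconst : ∀ {u : k[X]}, u.natDegree = 0 → ∀ c, Polynomial.taylor c u - u = 0 := by
    intro u hu c
    rw [Polynomial.eq_C_of_natDegree_eq_zero hu, Polynomial.taylor_C, sub_self]
  have hne : ∀ {u : k[X]}, u ≠ 0 → ∀ {p}, u.natDegree = p + 1 → ∀ {c : k},
      Polynomial.taylor c u - u = 0 → ((p + 1 : ℕ) : k) * c = 0 := by
    intro u hu p hp c hc
    have h2 := coeff_taylor_sub hp c
    rw [hc, Polynomial.coeff_zero, eq_comm, mul_eq_zero] at h2
    push_cast
    exact h2.resolve_right (Polynomial.leadingCoeff_ne_zero.2 hu)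
  rcases hp : f.natDegree with _ | p <;> rcases hq : g.natDegree with _ | q
  · simp
  · rw [hconst hp, mul_zero, eq_comm, mul_eq_zero] at h1
    rw [hne hg hq (h1.resolve_left hf)]
    simp
  · rw [hconst hq, mul_zero, mul_eq_zero] at h1
    rw [hne hf hp (h1.resolve_left hg)]
    simp
  · have h2 := Polynomial.coeff_mul_add_eq_of_natDegree_le hq.le (natDegree_taylor_sub_le hp y)
    have h3 := Polynomial.coeff_mul_add_eq_of_natDegree_le hp.le (natDegree_taylor_sub_le hq x)
    rw [coeff_taylor_sub hp, ← hq, Polynomial.coeff_natDegree] at h2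
    rw [coeff_taylor_sub hq, ← hp, Polynomial.coeff_natDegree] at h3
    rw [h1, show g.natDegree + p = f.natDegree + q by omega, h3] at h2
    have h4 : f.leadingCoeff * g.leadingCoeff ≠ 0 :=
      mul_ne_zero (Polynomial.leadingCoeff_ne_zero.2 hf) (Polynomial.leadingCoeff_ne_zero.2 hg)
    push_cast
    refine mul_left_cancel₀ h4 ?_
    linear_combination -h2

end Taylor

/-- Evaluation of the first variable. -/
def evalFst (x : k) : HTwo k →ₐ[k] k[X] :=
  Algebra.TensorProduct.lift (Polynomial.aeval (Polynomial.C x)) (AlgHom.id k k[X])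
    fun _ _ => Commute.all _ _

theorem eval_evalFst (x z : k) (t : HTwo k) : (evalFst x t).eval z = evalTwo x z t := by
  have : (Polynomial.aeval z).comp (Algebra.TensorProduct.lift
      (Polynomial.aeval (Polynomial.C x)) (AlgHom.id k k[X]) fun _ _ => Commute.all _ _) =
      evalTensorTwo x z := by
    ext <;> simp [evalTensorTwo]
  have h2 := DFunLike.congr_fun this t
  rw [← Polynomial.coe_aeval_eq_eval]
  exact h2

variable [CharZero k]

/-- The hypothesis has the shape of `natDegree_mul_eq_of_taylor` for `f = η(x,·)` and `g = η(y,·)`.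
Taking `y = -x` with `x ≠ 0` makes the two degrees sum to zero, so `η(x,·)` is constant; comparing
it with any other nonzero `η(y,·)` makes that one constant too. -/
theorem evalTwo_eq_of_leibniz {η : HTwo k}
    (h : ∀ x y z, evalTwo y z η * evalTwo x (y + z) η = evalTwo x z η * evalTwo y (x + z) η)
    (y z : k) : evalTwo y z η = evalTwo y 0 η := by
  have key : ∀ x y, evalFst x η ≠ 0 → evalFst y η ≠ 0 →
      ((evalFst x η).natDegree : k) * y = (evalFst y η).natDegree * x := by
    intro x y hx hy
    refine natDegree_mul_eq_of_taylor hx hy (Polynomial.funext fun z => ?_)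
    rw [Polynomial.eval_mul, Polynomial.eval_mul, Polynomial.taylor_eval, Polynomial.taylor_eval,
      eval_evalFst, eval_evalFst, eval_evalFst, eval_evalFst, add_comm z y, add_comm z x, h]
  by_cases hy : evalFst y η = 0
  · rw [← eval_evalFst, ← eval_evalFst, hy, Polynomial.eval_zero, Polynomial.eval_zero]
  obtain ⟨z₀, hz₀⟩ : ∃ z₀, (evalFst y η).eval z₀ ≠ 0 := by
    by_contra! h0
    exact hy (Polynomial.funext fun z => by rw [h0, Polynomial.eval_zero])
  set ψ := evalFst z₀ (swapTwoH k η) with hψ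
  have hψe : ∀ x, ψ.eval x = (evalFst x η).eval z₀ := fun x => by
    rw [hψ, eval_evalFst, evalTwo_swapTwoH, eval_evalFst]
  have hψ0 : ψ ≠ 0 := by
    intro h0
    rw [← hψe, h0, Polynomial.eval_zero] at hz₀
    exact hz₀ rfl
  -- A point where `x`, `η(x, z₀)` and `η(-x, z₀)` are all nonzero: the product polynomial is
  -- nonzero and the field is infinite.
  obtain ⟨x, hx⟩ : ∃ x, (Polynomial.X * (ψ * ψ.comp (-Polynomial.X))).eval x ≠ 0 := by
    by_contra! h0
    have h1 : Polynomial.X * (ψ * ψ.comp (-Polynomial.X)) = 0 :=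
      Polynomial.funext fun z => by rw [h0, Polynomial.eval_zero]
    have h2 : ψ.comp (-Polynomial.X) ≠ 0 := fun h2 => hψ0 <| by
      have := congrArg (fun f => f.comp (-Polynomial.X)) h2
      simpa [Polynomial.comp_assoc] using this
    exact mul_ne_zero Polynomial.X_ne_zero (mul_ne_zero hψ0 h2) h1
  rw [Polynomial.eval_mul, Polynomial.eval_mul, Polynomial.eval_comp, Polynomial.eval_neg,
    Polynomial.eval_X, hψe, hψe] at hx
  have hx0 : x ≠ 0 := left_ne_zero_of_mul hx
  have hx1 : evalFst x η ≠ 0 := fun h0 => hx (by simp [h0])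
  have hx2 : evalFst (-x) η ≠ 0 := fun h0 => hx (by simp [h0])
  have h1 := key x (-x) hx1 hx2
  have h2 : (((evalFst x η).natDegree + (evalFst (-x) η).natDegree : ℕ) : k) * x = 0 := by
    push_cast
    linear_combination -h1
  have h3 : (evalFst x η).natDegree + (evalFst (-x) η).natDegree = 0 := by
    exact_mod_cast (mul_eq_zero.1 h2).resolve_right hx0
  have h4 := key x y hx1 hy
  rw [(Nat.add_eq_zero_iff.1 h3).1, Nat.cast_zero, zero_mul, eq_comm, mul_eq_zero] at h4
  have h5 : (evalFst y η).natDegree = 0 := by exact_mod_cast h4.resolve_right hx0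
  rw [← eval_evalFst, ← eval_evalFst, Polynomial.eq_C_of_natDegree_eq_zero h5, Polynomial.eval_C,
    Polynomial.eval_C]

/-- With `η = f ⊗ 1` the first equation reads `(l₁ x - y + κ₁) f(x + y) = -y f(y)`. If `f ≠ 0`, then
`x = 0` gives `κ₁ = 0`, `y = 0` gives `l₁ = 0`, and `y = 1` shows that `f` is constant. -/
theorem eq_smul_one_of_equations {η : HTwo k} {l₁ l₂ κ₁ κ₂ : k}
    (h : ∀ x y z, (l₁ * x - y + κ₁) * evalTwo (x + y) z η =
      (l₂ * x - y - z + κ₂) * evalTwo y z η - (l₂ * x - z + κ₂) * evalTwo y (x + z) η)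
    (h' : ∀ x y z, evalTwo y z η * evalTwo x (y + z) η = evalTwo x z η * evalTwo y (x + z) η) :
    ∃ a : k, η = a • tens 1 1 ∧ a * l₁ = 0 ∧ a * κ₁ = 0 := by
  have hc := evalTwo_eq_of_leibniz h'
  set f := evalFst 0 (swapTwoH k η) with hf
  have hfe : ∀ x z, evalTwo x z η = f.eval x := fun x z => by
    rw [hc, hf, eval_evalFst, evalTwo_swapTwoH]
  simp only [hfe] at h
  have h1 : ∀ x y, (l₁ * x - y + κ₁) * f.eval (x + y) = -y * f.eval y := fun x y => by
    rw [h x y 0]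
    ring
  by_cases hf0 : f = 0
  · exact ⟨0, HTwo.ext_eval fun x y => by rw [hfe, hf0]; simp, by simp, by simp⟩
  have hκ : κ₁ = 0 := by
    by_contra hκ
    refine hf0 (Polynomial.funext fun y => ?_)
    have h2 := h1 0 y
    rw [zero_add] at h2
    rw [Polynomial.eval_zero]
    exact (mul_eq_zero.1 (show κ₁ * f.eval y = 0 by linear_combination h2)).resolve_left hκ
  subst hκ
  have hl : l₁ = 0 := by
    by_contra hl
    refine mul_ne_zero Polynomial.X_ne_zero hf0 (Polynomial.funext fun x => ?_)
    have h2 := h1 x 0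
    rw [add_zero, add_zero] at h2
    rw [Polynomial.eval_mul, Polynomial.eval_X, Polynomial.eval_zero]
    exact (mul_eq_zero.1 (show l₁ * (x * f.eval x) = 0 by linear_combination h2)).resolve_left hl
  subst hl
  refine ⟨f.eval 1, HTwo.ext_eval fun x y => ?_, mul_zero _, mul_zero _⟩
  have h2 := h1 (x - 1) 1
  rw [sub_add_cancel] at h2
  rw [hfe, map_smul, evalTwo_tens, Polynomial.eval_one, Polynomial.eval_one, smul_eq_mul]
  linear_combination -h2

/-! ### The type `m` as an invariant of `α'_m`. -/

section HasType

theorem coeffTwo_sum_monom (m : ℕ) (c : ℕ → ℕ → k) (i j : ℕ) :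
    coeffTwo i j
      (∑ p ∈ Finset.range (m + 1), ∑ q ∈ Finset.range (m + 1), c p q • monom k p q) =
        if i < m + 1 ∧ j < m + 1 then c i j else 0 := by
  simp only [map_sum, map_smul, coeffTwo_monom, smul_eq_mul, mul_ite, mul_one, mul_zero, ite_and]
  simp

theorem HasType.coeffTwo_support {m : ℕ} {A : HTwo k} (h : HasType m A) :
    (∀ i j, m < i ∨ m < j → coeffTwo i j A = 0) ∧
      (m ≠ 0 → ∃ i j, (i = m ∨ j = m) ∧ coeffTwo i j A ≠ 0) := by
  obtain ⟨rfl, rfl⟩ | ⟨hm, c, rfl, i, hi, hci⟩ := h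
  · simp
  refine ⟨fun i j hij => by rw [coeffTwo_sum_monom, if_neg (by omega)], fun _ => ?_⟩
  rcases hci with h | h
  · exact ⟨i, m, Or.inr rfl, by rw [coeffTwo_sum_monom, if_pos (by omega)]; exact h⟩
  · exact ⟨m, i, Or.inl rfl, by rw [coeffTwo_sum_monom, if_pos (by omega)]; exact h⟩

/-- For `A ≠ 0`, `m` is the largest divided-power index occurring in either factor of `A`, provided
`m > 0`. -/
theorem HasType.unique {m m' : ℕ} {A : HTwo k} (h : HasType m A) (h' : HasType m' A) :
    m = m' := by
  have key : ∀ {m m' : ℕ}, HasType m A → HasType m' A → ¬ m < m' := by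
    intro m m' h h' hlt
    obtain ⟨i, j, hij, hne⟩ := h'.coeffTwo_support.2 (by omega)
    exact hne (h.coeffTwo_support.1 i j (by omega))
  have := key h h'
  have := key h' h
  omega

theorem hasType_of_coeffTwo {m : ℕ} {A : HTwo k} (hm : 0 < m)
    (h : ∀ i j, m < i ∨ m < j → coeffTwo i j A = 0) {i : ℕ} (hi : i ≤ m)
    (hne : coeffTwo i m A ≠ 0) : HasType m A := by
  refine Or.inr ⟨hm, fun i j => coeffTwo i j A, HTwo.ext_coeff fun i j => ?_, i, hi, Or.inl hne⟩
  rw [coeffTwo_sum_monom]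
  split_ifs
  · rfl
  · exact h i j (by omega)

end HasType

/-! ### Matching the solutions with the five kinds. -/

section Kinds

theorem coeffTwo_asym_of_lt {m i j p q : ℕ} (hp : p ≤ m) (hq : q ≤ m) (h : m < i ∨ m < j) :
    coeffTwo i j (asym k p q) = 0 := by
  rw [coeffTwo_asym, if_neg (by omega), if_neg (by omega), sub_zero]

theorem Kind.Holds.hasType {t : Kind} {m : ℕ} {l₁ l₂ κ₁ κ₂ : k} {A η : HTwo k}
    (h : t.Holds m l₁ l₂ κ₁ κ₂ A η) : HasType m A := by
  cases t
  · exact Or.inl ⟨h.1, h.2.1⟩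
  · obtain ⟨rfl, -, -, ⟨w, hw, rfl⟩, -⟩ := h
    refine hasType_of_coeffTwo one_pos (fun i j hij => ?_) zero_le_one ?_
    · rw [map_smul, coeffTwo_asym_of_lt (by omega) le_rfl hij, smul_zero]
    · simpa [coeffTwo_asym] using hw
  · obtain ⟨rfl, -, -, -, -, w, hw, rfl⟩ := h
    refine hasType_of_coeffTwo two_pos (fun i j hij => ?_) zero_le_two ?_
    · simp [coeffTwo_asym_of_lt (m := 2) _ _ hij]
    · simpa [coeffTwo_asym] using hw
  · obtain ⟨rfl, -, -, -, -, w, hw, rfl⟩ := h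
    -- The entry `(1,2)` equals `w`, whereas the entry `(0,2)` is `-w κ₁` and may vanish.
    refine hasType_of_coeffTwo two_pos (fun i j hij => ?_) one_le_two ?_
    · simp [coeffTwo_asym_of_lt (m := 2) _ _ hij]
    · simpa [coeffTwo_asym] using hw
  · obtain ⟨rfl, -, -, -, -, w, hw, rfl⟩ := h
    refine hasType_of_coeffTwo three_pos (fun i j hij => ?_) (Nat.zero_le 3) ?_
    · simp [coeffTwo_asym_of_lt (m := 3) _ _ hij]
    · simpa [coeffTwo_asym] using hw

omit [CharZero k] in
theorem evalTwo_asym (x y : k) (i j : ℕ) : evalTwo x y (asym k i j) =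
    (x ^ i * y ^ j - x ^ j * y ^ i) * ((i.factorial : k)⁻¹ * (j.factorial : k)⁻¹) := by
  simp [asym, monom, dpow]
  ring

theorem Kind.Holds.equations {t : Kind} {m : ℕ} {l₁ l₂ κ₁ κ₂ : k} {A η : HTwo k}
    (h : t.Holds m l₁ l₂ κ₁ κ₂ A η) :
    (∀ x y, evalTwo x y A = -evalTwo y x A) ∧
    (∀ x y z, (l₁ * x - y + κ₁) * evalTwo (x + y) z A +
      (l₁ * x - z + κ₁) * evalTwo y (x + z) A = (l₂ * x - y - z + κ₂) * evalTwo y z A) ∧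
    ∃ a : k, η = a • tens 1 1 ∧ a * l₁ = 0 ∧ a * κ₁ = 0 ∧
      ∀ x y z, a * (evalTwo x y A + evalTwo y z A - evalTwo x z A) = 0 := by
  cases t
  · obtain ⟨-, rfl, a, rfl, hl, hκ⟩ := h
    simp only [map_zero]
    exact ⟨by simp, by simp, a, rfl, hl, hκ, by simp⟩
  · obtain ⟨-, rfl, rfl, ⟨w, -, rfl⟩, a, rfl, hl, hκ⟩ := h
    simp only [map_smul, evalTwo_asym, smul_eq_mul, Nat.factorial]
    refine ⟨fun x y => ?_, fun x y z => ?_, a, rfl, hl, hκ, fun x y z => ?_⟩ <;> ring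
  · obtain ⟨-, rfl, rfl, rfl, rfl, w, -, rfl⟩ := h
    simp only [map_smul, map_sub, evalTwo_asym, smul_eq_mul, Nat.factorial]
    refine ⟨fun x y => ?_, fun x y z => ?_, 0, by simp, by simp, by simp, by simp⟩ <;>
      push_cast <;> ring
  · obtain ⟨-, rfl, rfl, rfl, rfl, w, -, rfl⟩ := h
    simp only [map_smul, map_sub, evalTwo_asym, smul_eq_mul, Nat.factorial]
    refine ⟨fun x y => ?_, fun x y z => ?_, 0, by simp, by simp, by simp, by simp⟩ <;>
      push_cast <;> ring
  · obtain ⟨-, rfl, rfl, rfl, rfl, w, -, rfl⟩ := h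
    simp only [map_smul, map_sub, map_add, evalTwo_asym, smul_eq_mul, Nat.factorial]
    refine ⟨fun x y => ?_, fun x y z => ?_, 0, by simp, by simp, by simp, by simp⟩ <;>
      push_cast <;> ring

omit [CharZero k] in
theorem Kind.Holds.le_three {t : Kind} {m : ℕ} {l₁ l₂ κ₁ κ₂ : k} {A η : HTwo k}
    (h : t.Holds m l₁ l₂ κ₁ κ₂ A η) : m ≤ 3 := by
  cases t <;> obtain ⟨rfl, -⟩ := h <;> omega

theorem Kind.Holds.unique {t t' : Kind} {m : ℕ} {l₁ l₂ κ₁ κ₂ : k} {A η : HTwo k}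
    (h : t.Holds m l₁ l₂ κ₁ κ₂ A η) (h' : t'.Holds m l₁ l₂ κ₁ κ₂ A η) : t = t' := by
  cases t <;> cases t' <;> first
    | rfl
    | (have h1 := h.1
       have h2 := h'.1
       omega)
    -- Only (C) and (D) share the same `m`; they differ in `λ₁`.
    | (have h1 := h.2.1
       have h2 := h'.2.1
       rw [h1] at h2
       norm_num at h2)

/-- Expanding the homogeneous solutions at `(x - κ₁, y - κ₁)` produces the lower-order terms with
`κ₁` in (C), (D) and (E); `[0,1]` is translation invariant. -/
theorem exists_kind_of_equations {l₁ l₂ κ₁ κ₂ a : k} {A : HTwo k} (hA0 : A ≠ 0)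
    (hA : ∀ x y, evalTwo x y A = -evalTwo y x A)
    (h : ∀ x y z, (l₁ * x - y + κ₁) * evalTwo (x + y) z A +
      (l₁ * x - z + κ₁) * evalTwo y (x + z) A = (l₂ * x - y - z + κ₂) * evalTwo y z A)
    (hl : a * l₁ = 0) (hκ : a * κ₁ = 0)
    (h₃ : ∀ x y z, a * (evalTwo x y A + evalTwo y z A - evalTwo x z A) = 0) :
    ∃ (t : Kind) (m : ℕ), t.Holds m l₁ l₂ κ₁ κ₂ A (a • tens 1 1) := by
  have hκ₂ : κ₂ = 2 * κ₁ := by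
    by_contra hne
    refine hA0 (HTwo.ext_eval fun y z => ?_)
    have h1 := h 0 y z
    rw [zero_add, zero_add] at h1
    rw [map_zero]
    refine (mul_eq_zero.1 (show (κ₂ - 2 * κ₁) * evalTwo y z A = 0 by
      linear_combination -h1)).resolve_left (sub_ne_zero.2 hne)
  subst hκ₂
  set G := translate κ₁ A with hG
  have hAG : ∀ x y, evalTwo x y A = evalTwo (x - κ₁) (y - κ₁) G := fun x y => by
    rw [hG, evalTwo_translate, sub_add_cancel, sub_add_cancel]
  have hG0 : G ≠ 0 := fun h0 => hA0 (HTwo.ext_eval fun x y => by rw [hAG, h0, map_zero, map_zero])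
  have hrec : CoeffRecursion (fun i j => coeffTwo i j G) l₁ l₂ := by
    refine coeffRecursion_of_evalTwo (fun x y => ?_) fun x y z => ?_
    · rw [hG, evalTwo_translate, evalTwo_translate, hA]
    · have h1 := h x (y + κ₁) (z + κ₁)
      rw [← add_assoc, ← add_assoc] at h1
      rw [hG, evalTwo_translate, evalTwo_translate, evalTwo_translate]
      linear_combination h1
  obtain ⟨w, hw, ⟨hl₂, hGw⟩ | ⟨hl₁, hl₂, hGw⟩ | ⟨hl₁, hl₂, hGw⟩ | ⟨hl₁, hl₂, hGw⟩⟩ :=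
    hrec.eq_asym hG0
  · refine ⟨.B, 1, rfl, hl₂, rfl, ⟨w, hw, HTwo.ext_eval fun x y => ?_⟩, a, rfl, hl, hκ⟩
    simp only [hAG, hGw, map_smul, evalTwo_asym, smul_eq_mul, Nat.factorial]
    ring
  · have ha : a = 0 := by simpa [hl₁] using hl
    refine ⟨.C, 2, rfl, hl₁, hl₂, rfl, by simp [ha], w, hw, HTwo.ext_eval fun x y => ?_⟩
    simp only [hAG, hGw, map_smul, map_sub, evalTwo_asym, smul_eq_mul, Nat.factorial]
    push_cast
    ring
  · have hAe : ∀ x y, evalTwo x y A = w * ((x - κ₁) * (y - κ₁) * (y - x)) / 2 := fun x y => by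
      simp only [hAG, hGw, map_smul, evalTwo_asym, smul_eq_mul, Nat.factorial]
      push_cast
      ring
    have ha : a = 0 := by
      -- In translated coordinates this is the point `(1, 2, 0)`: both values of `A` involving the
      -- coordinate `0` vanish, and the third equals `w`.
      have h1 := h₃ (1 + κ₁) (2 + κ₁) κ₁
      simp only [hAe] at h1
      exact (mul_eq_zero.1 (show a * w = 0 by linear_combination h1)).resolve_right hw
    refine ⟨.D, 2, rfl, hl₁, hl₂, rfl, by simp [ha], w, hw, HTwo.ext_eval fun x y => ?_⟩
    simp only [hAe, map_smul, map_sub, evalTwo_asym, smul_eq_mul, Nat.factorial]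
    push_cast
    ring
  · have ha : a = 0 := by simpa [hl₁] using hl
    refine ⟨.E, 3, rfl, hl₁, hl₂, rfl, by simp [ha], w, hw, HTwo.ext_eval fun x y => ?_⟩
    simp only [hAG, hGw, map_smul, map_sub, map_add, evalTwo_asym, smul_eq_mul, Nat.factorial]
    push_cast
    ring

variable {L : Type*} [AddCommGroup L] [Module k[X] L]

theorem IsMType.exists_kind {P : Pseudoalgebra k L} {e : Module.Basis (Fin 3) k[X] L} {m : ℕ}
    {l₁ l₂ κ₁ κ₂ : k} {A η : HTwo k} (h : IsMType P e m l₁ l₂ κ₁ κ₂ A η) :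
    ∃ t : Kind, t.Holds m l₁ l₂ κ₁ κ₂ A η := by
  obtain ⟨hA, h₁, h₂, h₃, h₄⟩ := h.evalTwo_equations
  obtain ⟨a, rfl, hl, hκ⟩ := eq_smul_one_of_equations h₂ h₄
  by_cases hA0 : A = 0
  · subst hA0
    exact ⟨.A, h.hasType.unique (Or.inl ⟨rfl, rfl⟩), rfl, a, rfl, hl, hκ⟩
  have h₃' : ∀ x y z, a * (evalTwo x y A + evalTwo y z A - evalTwo x z A) = 0 := by
    intro x y z
    have h5 := h₃ x y z
    simp only [map_smul, evalTwo_tens, Polynomial.eval_one, smul_eq_mul] at h5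
    linear_combination -h5
  obtain ⟨t, m', ht⟩ := exists_kind_of_equations hA0 hA h₁ hl hκ h₃'
  obtain rfl := h.hasType.unique ht.hasType
  exact ⟨t, ht⟩

end Kinds

end

end SchrodingerVirasoro

end

theorem theorem3p1 {k : Type*} [Field k] [CharZero k] :
    (∀ {L : Type*} [AddCommGroup L] [Module k[X] L] (P : Pseudoalgebra k L)
        (e : Module.Basis (Fin 3) k[X] L) (m : ℕ) (l₁ l₂ κ₁ κ₂ : k) (A η : HTwo k),
        IsMType P e m l₁ l₂ κ₁ κ₂ A η →
          m ≤ 3 ∧ ∃! t : Kind, t.Holds m l₁ l₂ κ₁ κ₂ A η) ∧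
    (∀ (t : Kind) (m : ℕ) (l₁ l₂ κ₁ κ₂ : k) (A η : HTwo k), t.Holds m l₁ l₂ κ₁ κ₂ A η →
        ∀ {L : Type*} [AddCommGroup L] [Module k[X] L] (e : Module.Basis (Fin 3) k[X] L),
          ∃ P : Pseudoalgebra k L, IsMType P e m l₁ l₂ κ₁ κ₂ A η ∧
            ∃ (Q : Pseudoalgebra k (Fin 4 → k[X])) (ι : L →ₗ[k[X]] (Fin 4 → k[X])),
              IsSV Q (Pi.basisFun k[X] (Fin 4)) m l₁ l₂ κ₁ κ₂ A η ∧
              P.IsHom Q ι ∧ ∀ i : Fin 3, ι (e i) = Pi.basisFun k[X] (Fin 4) i.castSucc) ∧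
    (∀ t : Kind, ∃ (m : ℕ) (l₁ l₂ κ₁ κ₂ : k) (A η : HTwo k),
        t.Holds m l₁ l₂ κ₁ κ₂ A η) := by
  refine ⟨?_, ?_, ?_⟩
  · intro L _ _ P e m l₁ l₂ κ₁ κ₂ A η h
    obtain ⟨t, ht⟩ := h.exists_kind
    exact ⟨ht.le_three, t, ht, fun t' ht' => ht'.unique ht⟩
  · intro t m l₁ l₂ κ₁ κ₂ A η h L _ _ e
    obtain ⟨hA, h₁, a, rfl, hl, hκ, h₃⟩ := h.equations
    exact exists_isMType_isSV e m l₁ l₂ κ₁ κ₂ A a h.hasType hA h₁ hl hκ h₃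
  · intro t
    cases t
    -- For (A) and (B), `λ₁ = κ₁ = 0` permits `a = 1`, so the examples have `η ≠ 0`.
    · exact ⟨0, 0, 0, 0, 0, 0, _, rfl, rfl, 1, rfl, mul_zero _, mul_zero _⟩
    · exact ⟨1, 0, _, 0, _, _, _, rfl, rfl, rfl, ⟨1, one_ne_zero, rfl⟩, 1, rfl, mul_zero _,
        mul_zero _⟩
    · exact ⟨2, _, _, 0, _, _, _, rfl, rfl, rfl, rfl, rfl, 1, one_ne_zero, rfl⟩
    · exact ⟨2, _, _, 0, _, _, _, rfl, rfl, rfl, rfl, rfl, 1, one_ne_zero, rfl⟩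
    · exact ⟨3, _, _, 0, _, _, _, rfl, rfl, rfl, rfl, rfl, 1, one_ne_zero, rfl⟩
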